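/- For $\varphi\in L^2(\mathbb R^3)$ let $\hat\varphi(p)=(2\pi)^{-3/2}\int_{\mathbb R^3}e^{-ip\cdot x}\varphi(x)\,dx$ denote its Fourier transform (understood in the Plancherel sense), and let $K_2(r)=\int_0^\infty e^{-r\cosh t}\cosh(2t)\,dt$, $r>0$, be the modified Bessel function of the second kind of order $2$. For $\lambda>0$ and $\varphi\in H^{1/2}(\mathbb R^3)$ put $$\Phi^\lambda_{\mathrm{off}}[\varphi]:=-\frac{12}{\pi}\int_{\mathbb R^6}dp\,dq\;\frac{\overline{\hat\varphi(p)}\,\hat\varphi(q)}{|p|^2+|q|^2+p\cdot q+\lambda}.$$ Then for every complex-valued $\varphi\in H^{1/2}(\mathbb R^3)$ and every $\lambda>0$ the integral above and the two integrals below converge absolutely, and $$\Phi^\lambda_{\mathrm{off}}[\varphi]=-24\pi\int_{\mathbb R^3}dx\;\frac{e^{-\sqrt\lambda\,|x|}}{|x|}\,|\varphi(x)|^2+\frac{4\sqrt3\,\lambda}{\pi}\int_{\mathbb R^6}dx\,dy\;\frac{|\varphi(x)-\varphi(y)|^2}{|x|^2+|y|^2+x\cdot y}\,K_2\!\left(\sqrt{\tfrac{4\lambda}{3}}\,\sqrt{|x|^2+|y|^2+x\cdot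 y}\right),$$ where the first term on the right-hand side is $\le 0$ and the second one is $\ge 0$. -/

import Mathlib

open MeasureTheory

/-- The modified Bessel function of the second kind (Macdonald function) `K_ν(x)`, `x > 0`,
for real order `ν`:
`K_ν(x) = ∫₀^∞ exp (-x cosh t) cosh (ν t) dt`. -/
noncomputable def besselK (ν x : ℝ) : ℝ :=
  ∫ t in Set.Ioi (0 : ℝ), Real.exp (-x * Real.cosh t) * Real.cosh (ν * t)

/-- Three-dimensional Euclidean space. -/
abbrev E3 : Type := EuclideanSpace ℝ (Fin 3)

/-- The (Plancherel) Fourier transform of `φ ∈ L²(ℝ³)` in the unitary convention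
`φ̂(p) = (2π)^{-3/2} ∫ e^{-i p·x} φ(x) dx`. Mathlib's `𝓕` has the phase `e^{-2π i p·x}` and no
prefactor, hence the rescaling. -/
noncomputable def fourierHat (φ : Lp ℂ 2 (volume : Measure E3)) (p : E3) : ℂ :=
  (((2 * Real.pi) ^ (-(3 / 2 : ℝ)) : ℝ) : ℂ) *
    (FourierTransform.fourier φ : Lp ℂ 2 (volume : Measure E3)) ((2 * Real.pi)⁻¹ • p)

/-- The quantity `x² + y² + x·y`, for `z = (x, y)`. -/
noncomputable def quadD (z : E3 × E3) : ℝ :=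
  ‖z.1‖ ^ 2 + ‖z.2‖ ^ 2 + inner ℝ z.1 z.2

/-- The integrand of the off-diagonal form, at `z = (p, q)`:
`conj (φ̂ p) φ̂ q / (p² + q² + p·q + lam)`. -/
noncomputable def offIntegrand (lam : ℝ) (φ : Lp ℂ 2 (volume : Measure E3)) (z : E3 × E3) : ℂ :=
  (starRingEnd ℂ) (fourierHat φ z.1) * fourierHat φ z.2 / ((quadD z + lam : ℝ) : ℂ)

/-- The off-diagonal form
`Φ_off^lam[φ] = -(12/π) ∫∫ conj (φ̂ p) φ̂ q / (p² + q² + p·q + lam) dp dq`. -/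
noncomputable def phiOff (lam : ℝ) (φ : Lp ℂ 2 (volume : Measure E3)) : ℂ :=
  -(12 / (Real.pi : ℂ)) * ∫ z : E3 × E3, offIntegrand lam φ z

/-- The integrand `e^{-√lam |x|} |φ(x)|² / |x|`. -/
noncomputable def singularIntegrand (lam : ℝ) (φ : Lp ℂ 2 (volume : Measure E3)) (x : E3) : ℝ :=
  Real.exp (-(Real.sqrt lam * ‖x‖)) / ‖x‖ * ‖φ x‖ ^ 2

/-- The integrand `|φ(x) - φ(y)|² / (x² + y² + x·y) * K₂(√(4 lam / 3) √(x² + y² + x·y))`,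
at `z = (x, y)`. -/
noncomputable def differenceIntegrand (lam : ℝ) (φ : Lp ℂ 2 (volume : Measure E3))
    (z : E3 × E3) : ℝ :=
  ‖φ z.1 - φ z.2‖ ^ 2 / quadD z *
    besselK 2 (Real.sqrt (4 * lam / 3) * Real.sqrt (quadD z))

open scoped FourierTransform ComplexInnerProductSpace ContDiff Real

/-! Write D(x,y) = |x|² + |y|² + x·y and 1/(D(p,q) + λ) = ∫₀^∞ e^{-(D(p,q)+λ)s} ds. For fixed s,
Parseval turns the Gaussian e^{-sD(p,q)} into a multiple of s⁻³ e^{-D(x,y)/(3s)}: inverting the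
matrix of D flips the sign of the cross term, and the conjugate on one of the two factors flips it
back, so the same form reappears (`integral_conj_mul_gaussian_quadD`). Integrating in s gives Φ_off
as a negative multiple of ∫∫ conj φ(x) φ(y) G(x,y), where G(x,y) = ∫₀^∞ e^{-λs} s⁻³ e^{-D/(3s)} ds =
(6λ/D) K₂(√(4λ/3) √D) (`integral_exp_mul_inv_cube`).

Now polarise: 2 Re(conj φ(x) φ(y)) = |φ(x)|² + |φ(y)|² - |φ(x) - φ(y)|². The third term is the K₂
integral. The first two agree because G is symmetric, and the marginal ∫ G(x,y) dy is the Yukawa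
potential 6√3 π² e^{-√λ|x|}/|x| (`lintegral_sq_norm_mul_heatKernel`).

All exchanges of integrals rest on ∫ |p| |φ̂(p)|² dp < ∞. A Schur test with kernel |p-q|⁻² yields
absolute convergence on the momentum side, and, through a Gaussian form of Parseval, the Hardy-Kato
bound for ∫ e^{-√λ|x|} |φ|²/|x|. That bound controls every integral on the position side. -/

theorem norm_gaussian_phase {V : Type*} [NormedAddCommGroup V] [InnerProductSpace ℝ V] (b : ℝ) (c k x : V) :
    ‖Complex.exp (-b * ‖x - c‖ ^ 2 + 2 * π * Complex.I * inner ℝ k x)‖ =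
      Real.exp (-b * ‖x - c‖ ^ 2) := by
  rw [Complex.norm_exp]
  congr 1
  have : ((-b * ‖x - c‖ ^ 2 + 2 * π * Complex.I * inner ℝ k x : ℂ)) =
    ((-b * ‖x - c‖ ^ 2 : ℝ) : ℂ) + ((2 * π * inner ℝ k x : ℝ) : ℂ) * Complex.I := by
    push_cast; ring
  rw [this]
  simp only [Complex.add_re, Complex.ofReal_re, Complex.re_ofReal_mul, Complex.I_re]
  ring

/-! ### Plancherel transform on L²: Parseval, the Sobolev weight, Gaussians. -/

section FourierL2

variable {V : Type*} [NormedAddCommGroup V] [InnerProductSpace ℝ V] [FiniteDimensional ℝ V]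
  [MeasurableSpace V] [BorelSpace V]

/-- On `L¹ ∩ L²` the Plancherel transform is given by the Fourier integral. -/
theorem coeFn_fourier_toLp_ae_eq {f : V → ℂ} (h1 : Integrable f) (h2 : MemLp f 2) :
    ((𝓕 (h2.toLp f) : Lp ℂ 2 (volume : Measure V)) : V → ℂ) =ᵐ[volume] 𝓕 f := by
  have hcont : Continuous (𝓕 f) :=
    VectorFourier.fourierIntegral_continuous Real.continuous_fourierChar continuous_inner h1
  apply ae_eq_of_integral_contDiff_smul_eq
  · exact (Lp.memLp _).locallyIntegrable one_le_two
  · exact hcont.locallyIntegrable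
  -- A test function is a Schwartz function, so the distributional definition of the transform of
  -- `f` can be paired with it; the transform is then moved across by Fubini.
  intro g g_smooth g_cpt
  have hg₁ : HasCompactSupport (Complex.ofRealCLM ∘ g) := g_cpt.comp_left rfl
  have hg₂ : ContDiff ℝ ∞ (Complex.ofRealCLM ∘ g) := by fun_prop
  set G := hg₁.toSchwartzMap hg₂ with hG
  have hGx : ∀ x, G x = (g x : ℂ) := fun x => by simp [hG]
  have key := congrArg (fun T => T G) (Lp.fourier_toTemperedDistribution_eq (h2.toLp f))
  simp only [TemperedDistribution.fourier_apply, Lp.toTemperedDistribution_apply] at key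
  calc ∫ x, g x • (𝓕 (h2.toLp f) : Lp ℂ 2 (volume : Measure V)) x
      = ∫ x, G x • (𝓕 (h2.toLp f) : Lp ℂ 2 (volume : Measure V)) x := by simp [hGx]
    _ = ∫ x, (𝓕 G) x • (h2.toLp f) x := key.symm
    _ = ∫ x, (𝓕 (G : V → ℂ)) x • f x := by
        apply integral_congr_ae
        filter_upwards [h2.coeFn_toLp] with x hx
        rw [hx, SchwartzMap.fourier_coe]
    _ = ∫ x, G x • 𝓕 f x :=
        VectorFourier.integral_fourierIntegral_smul_eq_flip (L := innerₗ V)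
          Real.continuous_fourierChar continuous_inner G.integrable h1 |>.trans (by
            simp only [flip_innerₗ]; rfl)
    _ = ∫ x, g x • 𝓕 f x := by simp [hGx]

theorem fourier_star_eq (g : V → ℂ) (p : V) :
    𝓕 (fun x => (starRingEnd ℂ) (g x)) p = (starRingEnd ℂ) (𝓕⁻ g p) := by
  rw [Real.fourier_eq', Real.fourierInv_eq', ← integral_conj]
  congr 1
  ext x
  have h2 : (starRingEnd ℂ) 2 = 2 := Complex.conj_ofReal 2
  simp [← Complex.exp_conj, h2]

/-- Parseval's identity, in bilinear form. -/
theorem integral_mul_eq_integral_fourier_mul (φ : Lp ℂ 2 (volume : Measure V)) {g : V → ℂ}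
    (h1 : Integrable g) (h2 : MemLp g 2) :
    ∫ x, φ x * g x = ∫ p, (𝓕 φ : Lp ℂ 2 (volume : Measure V)) p * 𝓕⁻ g p := by
  have h1' : Integrable (fun x => (starRingEnd ℂ) (g x)) :=
    (LinearIsometryEquiv.integrable_comp_iff (Complex.conjLIE)).2 h1
  have h2' : MemLp (fun x => (starRingEnd ℂ) (g x)) 2 := h2.star
  have := Lp.inner_fourier_eq (h2'.toLp _) φ
  rw [L2.inner_def, L2.inner_def] at this
  calc ∫ x, φ x * g x = ∫ x, ⟪(h2'.toLp _) x, φ x⟫ := by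
        apply integral_congr_ae
        filter_upwards [h2'.coeFn_toLp] with x hx
        rw [hx]; simp
    _ = _ := this.symm
    _ = _ := by
        apply integral_congr_ae
        filter_upwards [coeFn_fourier_toLp_ae_eq h1' h2'] with x hx
        rw [hx, fourier_star_eq]; simp

/-- The Sobolev condition supplies an L² function `f'` equal to weight times transform only as a
distribution. Multiplying by the inverse weight, which is bounded since s ≥ 0, stays in L², and
injectivity of L² into distributions makes the identity hold almost everywhere. -/
theorem memLp_weight_mul_fourier_of_memSobolev {s : ℝ} (hs : 0 ≤ s) {φ : Lp ℂ 2 (volume : Measure V)}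
    (hφ : TemperedDistribution.MemSobolev s 2 (Lp.toTemperedDistribution φ)) :
    MemLp (fun p => (((1 + ‖p‖ ^ 2) ^ (s / 2) : ℝ) : ℂ) *
      (𝓕 φ : Lp ℂ 2 (volume : Measure V)) p) 2 := by
  obtain ⟨f', hf'⟩ := TemperedDistribution.memSobolev_iff_exists_smulLeftCLM_fourier.1 hφ
  rw [Lp.fourier_toTemperedDistribution_eq] at hf'
  have hw : MemLp (fun p : V => (((1 + ‖p‖ ^ 2) ^ (-s / 2) : ℝ) : ℂ)) ⊤ := by
    apply memLp_top_of_bound (C := 1)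
    · have : (fun x : V ↦ (((1 + ‖x‖ ^ 2) ^ (-s / 2) : ℝ) : ℂ)).HasTemperateGrowth := by
        fun_prop
      exact this.1.continuous.aestronglyMeasurable
    · filter_upwards with x
      rw [Complex.norm_real, Real.norm_eq_abs, abs_of_nonneg (by positivity)]
      exact Real.rpow_le_one_of_one_le_of_nonpos (by nlinarith [sq_nonneg ‖x‖]) (by linarith)
  have h1 : (𝓕 φ : Lp ℂ 2 (volume : Measure V)) = (hw.toLp _) • f' := by
    have hinj : Function.Injective (Lp.toTemperedDistributionCLM ℂ (volume : Measure V) 2) :=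
      LinearMap.ker_eq_bot.1 Lp.ker_toTemperedDistributionCLM_eq_bot
    apply hinj
    simp only [Lp.toTemperedDistributionCLM_apply]
    rw [Lp.toTemperedDistribution_smul_eq (by fun_prop), ← hf',
      TemperedDistribution.smulLeftCLM_smulLeftCLM_apply (by fun_prop) (by fun_prop)]
    convert! (TemperedDistribution.smulLeftCLM_const 1
      (Lp.toTemperedDistribution (𝓕 φ : Lp ℂ 2 (volume : Measure V)))).symm using 1
    · simp
    · congr
      ext x
      rw [Pi.mul_apply]
      norm_cast
      rw [← Real.rpow_add (by positivity)]
      ring_nf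
      simp
  refine (memLp_congr_ae ?_).1 (Lp.memLp f')
  rw [h1]
  filter_upwards [Lp.coeFn_lpSMul (r := 2) (hw.toLp _) f', hw.coeFn_toLp] with x hx hx'
  rw [hx, Pi.smul_apply', hx', smul_eq_mul, ← mul_assoc, ← Complex.ofReal_mul,
    ← Real.rpow_add (by positivity)]
  ring_nf
  simp

/-- The only form in which the hypothesis φ ∈ H^{1/2} is used later. -/
theorem integrable_norm_mul_sq_fourier_of_memSobolev {φ : Lp ℂ 2 (volume : Measure V)}
    (hφ : TemperedDistribution.MemSobolev (1 / 2 : ℝ) 2 (Lp.toTemperedDistribution φ)) :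
    Integrable (fun p => ‖p‖ * ‖(𝓕 φ : Lp ℂ 2 (volume : Measure V)) p‖ ^ 2) := by
  have h := (memLp_weight_mul_fourier_of_memSobolev (by norm_num) hφ).integrable_norm_pow
    two_ne_zero
  refine h.mono' ?_ ?_
  · have := (Lp.aestronglyMeasurable (𝓕 φ : Lp ℂ 2 (volume : Measure V)))
    fun_prop
  · filter_upwards with p
    rw [Real.norm_eq_abs, abs_of_nonneg (by positivity), norm_mul, mul_pow, Complex.norm_real,
      Real.norm_eq_abs, abs_of_nonneg (by positivity)]
    gcongr
    rw [← Real.rpow_natCast, ← Real.rpow_mul (by positivity)]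
    norm_num
    rw [← Real.sqrt_eq_rpow]
    exact Real.le_sqrt_of_sq_le (by linarith)

theorem integrable_gaussian_phase {b : ℝ} (hb : 0 < b) (c k : V) :
    Integrable (fun x : V => Complex.exp (-b * ‖x - c‖ ^ 2 + 2 * π * Complex.I * inner ℝ k x)) := by
  have h := ((GaussianFourier.integrable_cexp_neg_mul_sq_norm_add (V := V) (b := (b : ℂ))
    (by simpa using hb) (2 * π * Complex.I) k).comp_sub_right c).mul_const
      (Complex.exp (2 * π * Complex.I * inner ℝ k c))
  refine h.congr (.of_forall fun x => ?_)
  simp only [← Complex.exp_add, inner_sub_right]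
  push_cast
  ring_nf

theorem memLp_gaussian_phase {b : ℝ} (hb : 0 < b) (c k : V) :
    MemLp (fun x : V => Complex.exp (-b * ‖x - c‖ ^ 2 + 2 * π * Complex.I * inner ℝ k x)) 2 := by
  rw [memLp_two_iff_integrable_sq_norm (integrable_gaussian_phase hb c k).1]
  refine (integrable_gaussian_phase (b := 2 * b) (by positivity) c k).norm.congr
    (.of_forall fun x => ?_)
  simp only [norm_gaussian_phase, ← Real.exp_nat_mul]
  congr 1
  push_cast
  ring

theorem fourierInv_gaussian_phase {b : ℝ} (hb : 0 < b) (c k p : V) :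
    𝓕⁻ (fun x : V => Complex.exp (-b * ‖x - c‖ ^ 2 + 2 * π * Complex.I * inner ℝ k x)) p =
      (π / b : ℂ) ^ (Module.finrank ℝ V / 2 : ℂ) *
        Complex.exp (-π ^ 2 * ‖p + k‖ ^ 2 / b + 2 * π * Complex.I * inner ℝ c (p + k)) := by
  rw [Real.fourierInv_eq', ← integral_add_right_eq_self _ c, Complex.exp_add, ← mul_assoc]
  have h := GaussianFourier.integral_cexp_neg_mul_sq_norm_add (V := V) (b := (b : ℂ))
    (by simpa using hb) (2 * π * Complex.I) (p + k)
  have hb' : (b : ℂ) ≠ 0 := by exact_mod_cast hb.ne'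
  rw [show -(π : ℂ) ^ 2 * ‖p + k‖ ^ 2 / b = (2 * π * Complex.I) ^ 2 * ‖p + k‖ ^ 2 / (4 * b) by
    rw [mul_pow, Complex.I_sq]; field_simp; ring, ← h, ← integral_mul_const]
  congr 1
  ext x
  simp only [smul_eq_mul, ← Complex.exp_add, add_sub_cancel_right, inner_add_left,
    inner_add_right, real_inner_comm x p, real_inner_comm c k]
  push_cast
  ring_nf

/-- Parseval's identity against a translated and modulated Gaussian. -/
theorem integral_mul_gaussian_phase (φ : Lp ℂ 2 (volume : Measure V)) {b : ℝ} (hb : 0 < b)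
    (c k : V) :
    ∫ x, φ x * Complex.exp (-b * ‖x - c‖ ^ 2 + 2 * π * Complex.I * inner ℝ k x) =
      (π / b : ℂ) ^ (Module.finrank ℝ V / 2 : ℂ) *
        ∫ p, (𝓕 φ : Lp ℂ 2 (volume : Measure V)) p *
        Complex.exp (-π ^ 2 * ‖p + k‖ ^ 2 / b + 2 * π * Complex.I * inner ℝ c (p + k)) := by
  rw [integral_mul_eq_integral_fourier_mul φ (integrable_gaussian_phase hb c k)
    (memLp_gaussian_phase hb c k), ← integral_const_mul]
  simp only [fourierInv_gaussian_phase hb]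
  congr 1
  ext p
  ring

end FourierL2

/-! ### One-dimensional integrals: K₂ and the Yukawa potential by subordination. -/

theorem image_const_mul_exp {a : ℝ} (ha : 0 < a) :
    (fun t => a * Real.exp t) '' Set.univ = Set.Ioi 0 := by
  ext y
  simp only [Set.image_univ, Set.mem_range, Set.mem_Ioi]
  constructor
  · rintro ⟨t, rfl⟩
    positivity
  · intro hy
    exact ⟨Real.log (y / a), by rw [Real.exp_log (by positivity)]; field_simp⟩

theorem integrableOn_Ioi_iff_integrable_exp_subst {a : ℝ} (ha : 0 < a) (F : ℝ → ℝ) :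
    IntegrableOn F (Set.Ioi 0) ↔ Integrable fun t => a * Real.exp t * F (a * Real.exp t) := by
  have h := integrableOn_image_iff_integrableOn_abs_deriv_smul (s := Set.univ)
    (f := fun t => a * Real.exp t) (f' := fun t => a * Real.exp t) MeasurableSet.univ
    (fun x _ => ((Real.hasDerivAt_exp x).const_mul a).hasDerivWithinAt)
    (fun x _ y _ hxy => Real.exp_injective (mul_left_cancel₀ ha.ne' hxy)) F
  rw [image_const_mul_exp ha, integrableOn_univ] at h
  rw [h]
  refine integrable_congr (.of_forall fun t => ?_)
  simp only [smul_eq_mul]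
  rw [abs_of_pos (by positivity)]

theorem integral_Ioi_exp_subst {a : ℝ} (ha : 0 < a) (F : ℝ → ℝ) :
    ∫ s in Set.Ioi 0, F s = ∫ t, a * Real.exp t * F (a * Real.exp t) := by
  have h := integral_image_eq_integral_abs_deriv_smul (s := Set.univ)
    (f := fun t => a * Real.exp t) (f' := fun t => a * Real.exp t) MeasurableSet.univ
    (fun x _ => ((Real.hasDerivAt_exp x).const_mul a).hasDerivWithinAt)
    (fun x _ y _ hxy => Real.exp_injective (mul_left_cancel₀ ha.ne' hxy)) F
  rw [image_const_mul_exp ha, Measure.restrict_univ] at h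
  rw [h]
  congr 1
  ext t
  simp only [smul_eq_mul]
  rw [abs_of_pos (by positivity)]

theorem integral_eq_integral_symmetrized {g : ℝ → ℝ} (hg : Integrable g) :
    ∫ t, g t = ∫ t, (g t + g (-t)) / 2 := by
  rw [integral_div, integral_add hg hg.comp_neg, integral_neg_eq_self]
  ring

/-- From e^u ≥ u³/3! at u = c/s; this tames the singularity at s = 0. -/
theorem inv_cube_mul_exp_le {c s : ℝ} (hc : 0 < c) (hs : 0 < s) :
    (s ^ 3)⁻¹ * Real.exp (-c / s) ≤ 6 / c ^ 3 := by
  have h := Real.pow_div_factorial_le_exp (c / s) (by positivity) 3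
  norm_num [Nat.factorial] at h
  rw [neg_div, Real.exp_neg, ← mul_inv, inv_le_comm₀ (by positivity) (by positivity), inv_div]
  calc c ^ 3 / 6 = s ^ 3 * ((c / s) ^ 3 / 6) := by field_simp
    _ ≤ _ := by gcongr

theorem integrableOn_exp_mul_inv_cube {lam c : ℝ} (hlam : 0 < lam) (hc : 0 < c) :
    IntegrableOn (fun s => Real.exp (-lam * s) * ((s ^ 3)⁻¹ * Real.exp (-c / s)))
      (Set.Ioi 0) := by
  refine ((exp_neg_integrableOn_Ioi 0 hlam).mul_const (6 / c ^ 3)).mono'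
    (by fun_prop) ?_
  filter_upwards [ae_restrict_mem measurableSet_Ioi] with s (hs : 0 < s)
  rw [Real.norm_eq_abs, abs_of_nonneg (by positivity)]
  gcongr
  exact inv_cube_mul_exp_le hc hs

theorem integrableOn_exp_mul_rpow {lam c : ℝ} (hlam : 0 < lam) (hc : 0 < c) :
    IntegrableOn (fun s => Real.exp (-lam * s) * (s ^ (-(3 / 2) : ℝ) * Real.exp (-c / s)))
      (Set.Ioi 0) := by
  refine ((exp_neg_integrableOn_Ioi 0 hlam).mul_const (1 + 6 / c ^ 3)).mono'
    (by fun_prop) ?_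
  filter_upwards [ae_restrict_mem measurableSet_Ioi] with s (hs : 0 < s)
  rw [Real.norm_eq_abs, abs_of_nonneg (by positivity)]
  gcongr
  -- This is t ≤ 1 + t² with t = s^{-3/2}, which reduces to the inverse cube.
  have h1 : s ^ (-(3 / 2) : ℝ) ≤ 1 + (s ^ 3)⁻¹ := by
    have h2 : (s ^ (-(3 / 2) : ℝ)) ^ 2 = (s ^ 3)⁻¹ := by
      rw [← Real.rpow_natCast, ← Real.rpow_mul hs.le, ← Real.rpow_natCast s 3,
        ← Real.rpow_neg hs.le]
      norm_num
    nlinarith [sq_nonneg (s ^ (-(3 / 2) : ℝ) - 1)]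
  calc s ^ (-(3 / 2) : ℝ) * Real.exp (-c / s)
      ≤ (1 + (s ^ 3)⁻¹) * Real.exp (-c / s) := by gcongr
    _ = Real.exp (-c / s) + (s ^ 3)⁻¹ * Real.exp (-c / s) := by ring
    _ ≤ _ := add_le_add (Real.exp_le_one_iff.2 (by
        rw [neg_div]; exact neg_nonpos.2 (by positivity))) (inv_cube_mul_exp_le hc hs)

/-- Since cosh t = 1 + 2 sinh²(t/2), the substitution w = sinh(t/2) makes the integral Gaussian.
This is the elementary closed form of 2 K_{1/2}(z). -/
theorem integral_exp_mul_cosh_half (z : ℝ) :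
    ∫ t : ℝ, Real.cosh (t / 2) * Real.exp (-z * Real.cosh t) =
      2 * Real.exp (-z) * √(π / (2 * z)) := by
  have hd : ∀ x ∈ Set.univ, HasDerivWithinAt (fun t => Real.sinh (t / 2))
      (Real.cosh (x / 2) * (1 / 2)) Set.univ x := fun x _ =>
    ((Real.hasDerivAt_sinh _).comp x ((hasDerivAt_id x).div_const 2)).hasDerivWithinAt
  have h := integral_image_eq_integral_abs_deriv_smul MeasurableSet.univ hd
    (fun x _ y _ hxy => by have := Real.sinh_injective hxy; linarith)
    (fun w => Real.exp (-(2 * z) * w ^ 2))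
  have himg : (fun t => Real.sinh (t / 2)) '' Set.univ = Set.univ := by
    rw [Set.image_univ, Set.range_eq_univ]
    intro y
    obtain ⟨t, ht⟩ := Real.sinh_surjective y
    exact ⟨2 * t, by simpa using ht⟩
  rw [himg, Measure.restrict_univ, integral_gaussian] at h
  rw [h, ← integral_const_mul]
  congr 1
  ext t
  have hc : Real.cosh t = 1 + 2 * Real.sinh (t / 2) ^ 2 := by
    have h1 := Real.cosh_two_mul (t / 2)
    have h2 := Real.cosh_sq (t / 2)
    rw [show 2 * (t / 2) = t by ring] at h1
    linarith
  rw [smul_eq_mul, abs_of_pos (by have := Real.cosh_pos (t / 2); positivity), hc,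
    show -z * (1 + 2 * Real.sinh (t / 2) ^ 2) = -z + -(2 * z) * Real.sinh (t / 2) ^ 2 by ring,
    Real.exp_add]
  ring

theorem integral_exp_mul_inv_cube {lam D : ℝ} (hlam : 0 < lam) (hD : 0 < D) :
    ∫ s in Set.Ioi 0, Real.exp (-lam * s) * ((s ^ 3)⁻¹ * Real.exp (-(D / 3) / s)) =
      6 * lam / D * besselK 2 (√(4 * lam / 3) * √D) := by
  -- The scale at which λs and D/(3s) balance: with s = a eᵗ their sum is 2λa cosh t, and s⁻³ ds
  -- becomes a⁻² e^{-2t} dt, whose even part gives cosh 2t.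
  set a := √(D / (3 * lam)) with ha_def
  have ha : 0 < a := by positivity
  have ha2 : a ^ 2 = D / (3 * lam) := Real.sq_sqrt (by positivity)
  have hDa : D = 3 * lam * a ^ 2 := by rw [ha2]; field_simp
  have hz : √(4 * lam / 3) * √D = 2 * (lam * a) := by
    rw [← Real.sqrt_mul (by positivity), Real.sqrt_eq_iff_eq_sq (by positivity) (by positivity),
      mul_pow, mul_pow, ha2]
    field_simp
    norm_num
  have hint := (integrableOn_Ioi_iff_integrable_exp_subst ha _).1
    (integrableOn_exp_mul_inv_cube hlam (c := D / 3) (by positivity))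
  have hg : ∀ t : ℝ, a * Real.exp t * (Real.exp (-lam * (a * Real.exp t)) *
      (((a * Real.exp t) ^ 3)⁻¹ * Real.exp (-(D / 3) / (a * Real.exp t)))) =
      (a ^ 2)⁻¹ * (Real.exp (-(2 * t)) * Real.exp (-(2 * (lam * a)) * Real.cosh t)) := by
    intro t
    have h1 : -(D / 3) / (a * Real.exp t) = -(lam * a) * Real.exp (-t) := by
      rw [Real.exp_neg, hDa]; field_simp
    have h2 : -(2 * (lam * a)) * Real.cosh t =
        -lam * (a * Real.exp t) + -(lam * a) * Real.exp (-t) := by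
      rw [Real.cosh_eq]; ring
    have h3 : Real.exp (-(2 * t)) = (Real.exp t ^ 2)⁻¹ := by
      rw [Real.exp_neg, two_mul, Real.exp_add, sq]
    rw [h1, h2, h3, Real.exp_add]
    field_simp
  simp only [hg] at hint
  rw [integral_Ioi_exp_subst ha]
  simp only [hg]
  rw [integral_eq_integral_symmetrized hint, besselK, hz]
  have h4 := integral_comp_abs (f := fun t => Real.exp (-(2 * (lam * a)) * Real.cosh t) *
      Real.cosh (2 * t))
  have h5 : (∫ t in Set.Ioi (0 : ℝ), Real.exp (-(2 * (lam * a)) * Real.cosh t) *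
      Real.cosh (2 * t)) = (∫ t, Real.exp (-(2 * (lam * a)) * Real.cosh |t|) *
      Real.cosh (2 * |t|)) / 2 := by rw [h4]; ring
  rw [h5, ← integral_div, ← integral_const_mul]
  congr 1
  ext t
  have h6 : Real.cosh (2 * |t|) = Real.cosh (2 * t) := by
    rw [← Real.cosh_abs (2 * t), abs_mul, abs_two]
  rw [h6, Real.cosh_abs, Real.cosh_neg, Real.cosh_eq (2 * t), hDa]
  field_simp
  ring_nf

theorem integral_exp_mul_rpow {lam r : ℝ} (hlam : 0 < lam) (hr : 0 < r) :
    ∫ s in Set.Ioi 0, Real.exp (-lam * s) * (s ^ (-(3 / 2) : ℝ) * Real.exp (-(r ^ 2 / 4) / s)) =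
      2 * √π * (Real.exp (-(√lam * r)) / r) := by
  -- Again the balancing scale, λa² = r²/4; here s^{-3/2} ds becomes a^{-1/2} e^{-t/2} dt, which
  -- leads to order 1/2.
  set a := r / (2 * √lam) with ha_def
  have hsl : 0 < √lam := Real.sqrt_pos.2 hlam
  have ha : 0 < a := by positivity
  have hla : lam * a = √lam * r / 2 := by
    rw [ha_def]
    nth_rw 1 [← Real.mul_self_sqrt hlam.le]
    field_simp
  have hra : r ^ 2 / 4 = lam * a ^ 2 := by
    rw [sq a, ← mul_assoc, hla, ha_def]
    field_simp
    norm_num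
  have hint := (integrableOn_Ioi_iff_integrable_exp_subst ha _).1
    (integrableOn_exp_mul_rpow hlam (c := r ^ 2 / 4) (by positivity))
  have hg : ∀ t : ℝ, a * Real.exp t * (Real.exp (-lam * (a * Real.exp t)) *
      ((a * Real.exp t) ^ (-(3 / 2) : ℝ) * Real.exp (-(r ^ 2 / 4) / (a * Real.exp t)))) =
      (√a)⁻¹ * (Real.exp (-(t / 2)) * Real.exp (-(√lam * r) * Real.cosh t)) := by
    intro t
    have h1 : -(r ^ 2 / 4) / (a * Real.exp t) = -(lam * a) * Real.exp (-t) := by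
      rw [Real.exp_neg, hra]; field_simp
    have h2 : -(√lam * r) * Real.cosh t =
        -lam * (a * Real.exp t) + -(lam * a) * Real.exp (-t) := by
      rw [show √lam * r = 2 * (lam * a) by rw [hla]; ring, Real.cosh_eq]; ring
    have h3 : a * Real.exp t * (a * Real.exp t) ^ (-(3 / 2) : ℝ) =
        (√a)⁻¹ * Real.exp (-(t / 2)) := by
      nth_rw 1 [← Real.rpow_one (a * Real.exp t)]
      rw [← Real.rpow_add (by positivity), Real.mul_rpow ha.le (Real.exp_pos t).le,
        Real.sqrt_eq_rpow, ← Real.rpow_neg ha.le, ← Real.exp_mul]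
      norm_num
      left
      ring
    rw [h1, h2, Real.exp_add]
    calc _ = (a * Real.exp t * (a * Real.exp t) ^ (-(3 / 2) : ℝ)) *
          (Real.exp (-lam * (a * Real.exp t)) * Real.exp (-(lam * a) * Real.exp (-t))) := by ring
      _ = _ := by rw [h3]; ring
  simp only [hg] at hint
  rw [integral_Ioi_exp_subst ha]
  simp only [hg]
  rw [integral_eq_integral_symmetrized hint]
  have h4 : ∀ t : ℝ, ((√a)⁻¹ * (Real.exp (-(t / 2)) * Real.exp (-(√lam * r) * Real.cosh t)) +
      (√a)⁻¹ * (Real.exp (-(-t / 2)) * Real.exp (-(√lam * r) * Real.cosh (-t)))) / 2 =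
      (√a)⁻¹ * (Real.cosh (t / 2) * Real.exp (-(√lam * r) * Real.cosh t)) := by
    intro t
    rw [Real.cosh_neg, Real.cosh_eq (t / 2)]
    ring_nf
  simp only [h4]
  rw [integral_const_mul, integral_exp_mul_cosh_half]
  have h5 : √(π / (2 * (√lam * r))) = √π * √a / r := by
    rw [Real.sqrt_eq_iff_eq_sq (by positivity) (by positivity), div_pow, mul_pow,
      Real.sq_sqrt (by positivity), Real.sq_sqrt ha.le, ha_def]
    field_simp
  rw [h5]
  field_simp

/-! ### Schur test for the kernel |p - q|⁻² on ℝ³. -/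

theorem integral_Ioi_inv_sq_add_sq {a : ℝ} (ha : 0 < a) :
    ∫ r in Set.Ioi (0 : ℝ), (r ^ 2 + a ^ 2)⁻¹ = π / 2 / a := by
  have h1 : ∀ r : ℝ, (r ^ 2 + a ^ 2)⁻¹ = (a ^ 2)⁻¹ * (1 + (a⁻¹ * r) ^ 2)⁻¹ := by
    intro r; rw [← mul_inv]; congr 1; field_simp; ring
  simp only [h1]
  rw [integral_const_mul, integral_comp_mul_left_Ioi (fun r => (1 + r ^ 2)⁻¹) 0 (by positivity),
    mul_zero, integral_Ioi_inv_one_add_sq, Real.arctan_zero]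
  simp
  field_simp

theorem integrable_inv_sq_add_sq {a : ℝ} (ha : 0 < a) :
    Integrable (fun r : ℝ => (r ^ 2 + a ^ 2)⁻¹) := by
  have h1 : ∀ r : ℝ, (r ^ 2 + a ^ 2)⁻¹ = (a ^ 2)⁻¹ * (1 + (a⁻¹ * r) ^ 2)⁻¹ := by
    intro r; rw [← mul_inv]; congr 1; field_simp; ring
  simp only [h1]
  exact (integrable_inv_one_add_sq.comp_mul_left' (inv_ne_zero ha.ne')).const_mul _

/-- In polar coordinates the Jacobian r² cancels the factor |q|⁻², leaving an arctangent integral.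
-/
theorem exists_lintegral_inv_sq_norm_mul_le : ∃ C : ℝ, 0 ≤ C ∧ ∀ a : ℝ, 0 < a →
    ∫⁻ q : E3, ENNReal.ofReal ((‖q‖ ^ 2 * (‖q‖ ^ 2 + a ^ 2))⁻¹) ≤ ENNReal.ofReal (C / a) := by
  refine ⟨3 * volume.real (Metric.ball (0 : E3) 1) * (π / 2), by positivity, fun a ha => ?_⟩
  have hf : Module.finrank ℝ E3 = 3 := by simp
  have hcongr : ∀ r ∈ Set.Ioi (0 : ℝ), r ^ (Module.finrank ℝ E3 - 1) •
      (r ^ 2 * (r ^ 2 + a ^ 2))⁻¹ = (r ^ 2 + a ^ 2)⁻¹ := by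
    intro r (hr : 0 < r)
    rw [hf, smul_eq_mul]
    field_simp
  have hint : Integrable (fun q : E3 => (‖q‖ ^ 2 * (‖q‖ ^ 2 + a ^ 2))⁻¹) := by
    rw [integrable_fun_norm_addHaar volume (f := fun r => (r ^ 2 * (r ^ 2 + a ^ 2))⁻¹),
      integrableOn_congr_fun hcongr measurableSet_Ioi]
    exact (integrable_inv_sq_add_sq ha).integrableOn
  rw [← ofReal_integral_eq_lintegral_ofReal hint (.of_forall fun q => by positivity),
    integral_fun_norm_addHaar volume (fun r => (r ^ 2 * (r ^ 2 + a ^ 2))⁻¹),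
    setIntegral_congr_fun measurableSet_Ioi hcongr, integral_Ioi_inv_sq_add_sq ha, hf]
  apply le_of_eq
  congr 1
  simp only [nsmul_eq_mul, smul_eq_mul]
  push_cast
  ring

theorem inv_mul_le_two_mul_inv {a b c : ℝ} (ha : 0 ≤ a) (hab : a ≤ b) (hcb : c ≤ b)
    (hc : 0 < c) : (a * b)⁻¹ ≤ 2 * (a * (a + c))⁻¹ := by
  have hb : 0 < b := hc.trans_le hcb
  rcases ha.eq_or_lt with rfl | ha
  · simp
  rw [← div_eq_mul_inv, inv_eq_one_div, div_le_div_iff₀ (by positivity) (by positivity)]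
  nlinarith

/-- The larger of |q| and |p-q| is at least |p|/2, so its square dominates half the sum of the
smaller square and (|p|/2)². The two terms cover the two cases. -/
theorem inv_sq_norm_mul_sq_norm_sub_le {V : Type*} [NormedAddCommGroup V] {p : V} (hp : p ≠ 0)
    (q : V) :
    (‖q‖ ^ 2 * ‖p - q‖ ^ 2)⁻¹ ≤ 2 * (‖q‖ ^ 2 * (‖q‖ ^ 2 + (‖p‖ / 2) ^ 2))⁻¹ +
      2 * (‖p - q‖ ^ 2 * (‖p - q‖ ^ 2 + (‖p‖ / 2) ^ 2))⁻¹ := by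
  have hp' : 0 < ‖p‖ := norm_pos_iff.2 hp
  have htri : ‖p‖ ≤ ‖q‖ + ‖p - q‖ := by
    simpa using norm_add_le q (p - q)
  rcases le_total ‖q‖ ‖p - q‖ with h | h
  · refine (inv_mul_le_two_mul_inv (by positivity) (by gcongr) ?_ (by positivity)).trans
      (le_add_of_nonneg_right (by positivity))
    gcongr
    linarith
  · rw [mul_comm (‖q‖ ^ 2) (‖p - q‖ ^ 2)]
    refine (inv_mul_le_two_mul_inv (by positivity) (by gcongr) ?_ (by positivity)).trans
      (le_add_of_nonneg_left (by positivity))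
    gcongr
    linarith

theorem exists_lintegral_inv_sq_norm_mul_sq_norm_sub_le : ∃ C : ℝ, 0 ≤ C ∧ ∀ p : E3, p ≠ 0 →
    ∫⁻ q : E3, ENNReal.ofReal ((‖q‖ ^ 2 * ‖p - q‖ ^ 2)⁻¹) ≤ ENNReal.ofReal (C / ‖p‖) := by
  obtain ⟨C, hC, h⟩ := exists_lintegral_inv_sq_norm_mul_le
  refine ⟨8 * C, by positivity, fun p hp => ?_⟩
  have hp' : 0 < ‖p‖ := norm_pos_iff.2 hp
  set F : E3 → ENNReal := fun q =>
    ENNReal.ofReal ((‖q‖ ^ 2 * (‖q‖ ^ 2 + (‖p‖ / 2) ^ 2))⁻¹) with hF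
  calc ∫⁻ q : E3, ENNReal.ofReal ((‖q‖ ^ 2 * ‖p - q‖ ^ 2)⁻¹)
      ≤ ∫⁻ q : E3, (2 * F q + 2 * F (p - q)) := by
        refine lintegral_mono fun q => ?_
        refine (ENNReal.ofReal_le_ofReal (inv_sq_norm_mul_sq_norm_sub_le hp q)).trans ?_
        rw [ENNReal.ofReal_add (by positivity) (by positivity),
          ENNReal.ofReal_mul zero_le_two, ENNReal.ofReal_mul zero_le_two]
        simp [hF]
    _ = 4 * ∫⁻ q, F q := by
        have hm : Measurable F := by fun_prop
        rw [lintegral_add_left (by fun_prop), lintegral_const_mul _ hm,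
          lintegral_const_mul _ (by fun_prop), lintegral_sub_left_eq_self F p, ← add_mul]
        norm_num
    _ ≤ 4 * ENNReal.ofReal (C / (‖p‖ / 2)) := by gcongr; exact h _ (by positivity)
    _ = ENNReal.ofReal (8 * C / ‖p‖) := by
        rw [show (4 : ENNReal) = ENNReal.ofReal 4 by simp, ← ENNReal.ofReal_mul (by norm_num)]
        congr 1
        field_simp
        ring

theorem integrable_sq_norm_mul_inv_sq_norm_sub {u : E3 → ℂ} (hu : AEStronglyMeasurable u)
    (h : Integrable fun p => ‖p‖ * ‖u p‖ ^ 2) :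
    Integrable (fun z : E3 × E3 =>
      ‖u z.1‖ ^ 2 * ‖z.1‖ ^ 2 * (‖z.2‖ ^ 2 * ‖z.1 - z.2‖ ^ 2)⁻¹) := by
  obtain ⟨C, hC, hle⟩ := exists_lintegral_inv_sq_norm_mul_sq_norm_sub_le
  have hu1 : AEMeasurable (fun z : E3 × E3 => u z.1) := hu.comp_fst.aemeasurable
  refine ⟨AEMeasurable.aestronglyMeasurable (by fun_prop), ?_⟩
  rw [hasFiniteIntegral_iff_ofReal (.of_forall fun z => by positivity), Measure.volume_eq_prod,
    lintegral_prod _ (by fun_prop)]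
  calc ∫⁻ p : E3, ∫⁻ q : E3, ENNReal.ofReal
          (‖u p‖ ^ 2 * ‖p‖ ^ 2 * (‖q‖ ^ 2 * ‖p - q‖ ^ 2)⁻¹)
      ≤ ∫⁻ p : E3, ENNReal.ofReal (C * (‖p‖ * ‖u p‖ ^ 2)) := by
        refine lintegral_mono_ae ?_
        filter_upwards [Measure.ae_ne volume (0 : E3)] with p hp
        have hp' : 0 < ‖p‖ := norm_pos_iff.2 hp
        simp only [ENNReal.ofReal_mul (show 0 ≤ ‖u p‖ ^ 2 * ‖p‖ ^ 2 by positivity)]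
        rw [lintegral_const_mul _ (by fun_prop)]
        refine (mul_le_mul_right (hle p hp) _).trans ?_
        rw [← ENNReal.ofReal_mul (by positivity)]
        apply le_of_eq
        congr 1
        field_simp
    _ < ⊤ := (h.const_mul C).lintegral_lt_top

/-- Schur test with weight |p|/|q|: AM-GM bounds |u(p)||u(q)| by |u(p)|²|p|²/|q|² plus its mirror
image, and ∫ |q|⁻²|p-q|⁻² dq ≤ C/|p| returns ∫ |p||u(p)|² dp. -/
theorem integrable_norm_mul_norm_mul_inv_sq_norm_sub {u : E3 → ℂ} (hu : AEStronglyMeasurable u)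
    (h : Integrable fun p => ‖p‖ * ‖u p‖ ^ 2) :
    Integrable (fun z : E3 × E3 => ‖u z.1‖ * ‖u z.2‖ * (‖z.1 - z.2‖ ^ 2)⁻¹) := by
  have h1 := integrable_sq_norm_mul_inv_sq_norm_sub hu h
  have h2 : Integrable (fun z : E3 × E3 =>
      ‖u z.2‖ ^ 2 * ‖z.2‖ ^ 2 * (‖z.1‖ ^ 2 * ‖z.2 - z.1‖ ^ 2)⁻¹) := h1.swap
  have hu1 : AEMeasurable (fun z : E3 × E3 => u z.1) := hu.comp_fst.aemeasurable
  have hu2 : AEMeasurable (fun z : E3 × E3 => u z.2) := hu.comp_snd.aemeasurable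
  refine (h1.add h2).mono' (AEMeasurable.aestronglyMeasurable (by fun_prop)) ?_
  have hne1 : ∀ᵐ z : E3 × E3, z.1 ≠ 0 :=
    Measure.quasiMeasurePreserving_fst.ae (Measure.ae_ne volume (0 : E3))
  have hne2 : ∀ᵐ z : E3 × E3, z.2 ≠ 0 :=
    Measure.quasiMeasurePreserving_snd.ae (Measure.ae_ne volume (0 : E3))
  filter_upwards [hne1, hne2] with z hz1 hz2
  have hP : 0 < ‖z.1‖ := norm_pos_iff.2 hz1
  have hQ : 0 < ‖z.2‖ := norm_pos_iff.2 hz2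
  rw [Real.norm_eq_abs, abs_of_nonneg (by positivity), Pi.add_apply, norm_sub_rev z.2 z.1,
    mul_inv, mul_inv, ← mul_assoc, ← mul_assoc, ← add_mul]
  gcongr
  have e1 : ‖u z.1‖ ^ 2 * ‖z.1‖ ^ 2 * (‖z.2‖ ^ 2)⁻¹ = (‖u z.1‖ * ‖z.1‖ / ‖z.2‖) ^ 2 := by
    field_simp
  have e2 : ‖u z.2‖ ^ 2 * ‖z.2‖ ^ 2 * (‖z.1‖ ^ 2)⁻¹ = (‖u z.2‖ * ‖z.2‖ / ‖z.1‖) ^ 2 := by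
    field_simp
  have e3 : ‖u z.1‖ * ‖u z.2‖ = (‖u z.1‖ * ‖z.1‖ / ‖z.2‖) * (‖u z.2‖ * ‖z.2‖ / ‖z.1‖) := by
    field_simp
  have h0 : 0 ≤ ‖u z.1‖ * ‖u z.2‖ := by positivity
  rw [e1, e2]
  nlinarith [sq_nonneg (‖u z.1‖ * ‖z.1‖ / ‖z.2‖ - ‖u z.2‖ * ‖z.2‖ / ‖z.1‖)]

/-! ### The quadratic form |x|² + |y|² + x·y. -/

/-- The difference of the two sides is 3|x+y|². This puts the off-diagonal denominator under the
Schur test. -/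
theorem sq_norm_sub_le_four_mul_quadD (z : E3 × E3) : ‖z.1 - z.2‖ ^ 2 ≤ 4 * quadD z := by
  have h1 := @norm_sub_sq_real E3 _ _ z.1 z.2
  have h2 := @norm_add_sq_real E3 _ _ z.1 z.2
  rw [quadD]
  nlinarith [sq_nonneg ‖z.1 + z.2‖]

theorem half_add_le_quadD (z : E3 × E3) : (‖z.1‖ ^ 2 + ‖z.2‖ ^ 2) / 2 ≤ quadD z := by
  have h2 := @norm_add_sq_real E3 _ _ z.1 z.2
  rw [quadD]
  nlinarith [sq_nonneg ‖z.1 + z.2‖]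

theorem quadD_nonneg (z : E3 × E3) : 0 ≤ quadD z :=
  (by positivity : (0 : ℝ) ≤ (‖z.1‖ ^ 2 + ‖z.2‖ ^ 2) / 2).trans (half_add_le_quadD z)

theorem continuous_quadD : Continuous quadD := by
  unfold quadD
  fun_prop

theorem quadD_swap (z : E3 × E3) : quadD z.swap = quadD z := by
  simp only [quadD, Prod.fst_swap, Prod.snd_swap, real_inner_comm z.1 z.2]
  ring

theorem quadD_eq_norm_sub (x y : E3) :
    quadD (x, y) = ‖y - (-(1 / 2 : ℝ) • x)‖ ^ 2 + 3 / 4 * ‖x‖ ^ 2 := by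
  rw [norm_sub_sq_real, quadD, inner_smul_right, norm_smul, mul_pow, real_inner_comm y x]
  norm_num
  ring

theorem ae_quadD_pos : ∀ᵐ z : E3 × E3, 0 < quadD z := by
  have hne1 : ∀ᵐ z : E3 × E3, z.1 ≠ 0 :=
    Measure.quasiMeasurePreserving_fst.ae (Measure.ae_ne volume (0 : E3))
  filter_upwards [hne1] with z hz
  have hP : 0 < ‖z.1‖ := norm_pos_iff.2 hz
  exact lt_of_lt_of_le (by positivity) (half_add_le_quadD z)

/-! ### Hardy-Kato bound for the Yukawa potential via Gaussian averages. -/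

theorem ofReal_cpow_three_half {b : ℝ} (hb : 0 < b) :
    (π / b : ℂ) ^ (Module.finrank ℝ E3 / 2 : ℂ) = (((π / b) ^ (3 / 2 : ℝ) : ℝ) : ℂ) := by
  rw [Complex.ofReal_cpow (by positivity)]
  simp

theorem integral_mul_gaussian_phase_three (φ : Lp ℂ 2 (volume : Measure E3)) {b : ℝ}
    (hb : 0 < b) (c k : E3) :
    ∫ x, φ x * Complex.exp (-b * ‖x - c‖ ^ 2 + 2 * π * Complex.I * inner ℝ k x) =
      (((π / b) ^ (3 / 2 : ℝ) : ℝ) : ℂ) *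
        ∫ p, (𝓕 φ : Lp ℂ 2 (volume : Measure E3)) p *
        Complex.exp (-π ^ 2 * ‖p + k‖ ^ 2 / b + 2 * π * Complex.I * inner ℝ c (p + k)) := by
  rw [integral_mul_gaussian_phase φ hb, ofReal_cpow_three_half hb]

/-- The Gaussian average of `|φ|²` is controlled by a Gaussian form in `|𝓕 φ|`. -/
theorem lintegral_sq_norm_mul_gaussian_le (φ : Lp ℂ 2 (volume : Measure E3)) {b : ℝ}
    (hb : 0 < b) :
    ∫⁻ x, ENNReal.ofReal (‖φ x‖ ^ 2 * Real.exp (-b * ‖x‖ ^ 2)) ≤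
      ∫⁻ p, ∫⁻ q, ENNReal.ofReal ((π / b) ^ (3 / 2 : ℝ) *
        (‖(𝓕 φ : Lp ℂ 2 (volume : Measure E3)) p‖ * ‖(𝓕 φ : Lp ℂ 2 (volume : Measure E3)) q‖ *
          Real.exp (-π ^ 2 * ‖p - q‖ ^ 2 / b))) := by
  set u : E3 → ℂ := ⇑(𝓕 φ : Lp ℂ 2 (volume : Measure E3)) with hu
  have hφm := (Lp.aestronglyMeasurable φ).aemeasurable
  have hexp : ∀ x : E3, Real.exp (-b * ‖x‖ ^ 2) ≤ 1 := fun x =>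
    Real.exp_le_one_iff.2 (by nlinarith [sq_nonneg ‖x‖])
  have hsq : Integrable (fun x => ‖φ x‖ ^ 2 * Real.exp (-b * ‖x‖ ^ 2)) := by
    refine ((Lp.memLp φ).integrable_norm_pow two_ne_zero).mono'
      (AEMeasurable.aestronglyMeasurable (by fun_prop)) (.of_forall fun x => ?_)
    rw [Real.norm_eq_abs, abs_of_nonneg (by positivity)]
    exact mul_le_of_le_one_right (by positivity) (hexp x)
  -- Parseval is applied to φ against conj φ times the Gaussian; the inverse transform of this `g`
  -- is the conjugate of a Gaussian convolution of `u`.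
  set g : E3 → ℂ := fun x => (starRingEnd ℂ) (φ x) * Complex.exp (-b * ‖x‖ ^ 2) with hg
  have hgauss : ∀ x : E3, Complex.exp (-b * ‖x‖ ^ 2) = ((Real.exp (-b * ‖x‖ ^ 2) : ℝ) : ℂ) := by
    intro x; push_cast; rfl
  have hgm : AEStronglyMeasurable g :=
    (Lp.aestronglyMeasurable φ).star.mul (by fun_prop)
  have hgauss2 : MemLp (fun x : E3 => Complex.exp (-b * ‖x‖ ^ 2)) 2 := by
    simpa using memLp_gaussian_phase (V := E3) hb 0 0
  have hg1 : Integrable g := (Lp.memLp φ).star.integrable_mul hgauss2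
  have hg2 : MemLp g 2 := by
    refine (Lp.memLp φ).of_le hgm (.of_forall fun x => ?_)
    rw [hg]
    simp only [norm_mul, RCLike.norm_conj, hgauss, Complex.norm_real, Real.norm_eq_abs,
      Real.abs_exp]
    exact mul_le_of_le_one_right (norm_nonneg _) (hexp x)
  have hinv : ∀ p, 𝓕⁻ g p = (starRingEnd ℂ) ((((π / b) ^ (3 / 2 : ℝ) : ℝ) : ℂ) *
      ∫ q, u q * Complex.exp (-π ^ 2 * ‖q - p‖ ^ 2 / b)) := by
    intro p
    have h := integral_mul_gaussian_phase_three φ hb 0 (-p)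
    simp only [inner_zero_left, Complex.ofReal_zero, mul_zero, add_zero, ← sub_eq_add_neg] at h
    rw [← h, Real.fourierInv_eq', ← integral_conj]
    congr 1
    ext x
    have h2 : (starRingEnd ℂ) 2 = 2 := Complex.conj_ofReal 2
    simp only [hg, smul_eq_mul, map_mul, ← Complex.exp_conj, map_neg, Complex.conj_ofReal,
      map_pow, Complex.conj_I, h2, sub_zero, Complex.exp_add, inner_neg_left,
      real_inner_comm x p]
    push_cast
    ring_nf
  have hpars := integral_mul_eq_integral_fourier_mul φ hg1 hg2
  have hlhs : ∫ x, φ x * g x = ((∫ x, ‖φ x‖ ^ 2 * Real.exp (-b * ‖x‖ ^ 2) : ℝ) : ℂ) := by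
    rw [← integral_complex_ofReal]
    congr 1
    ext x
    rw [hg]
    simp only [hgauss, ← mul_assoc, Complex.mul_conj']
    push_cast
    ring
  rw [hlhs] at hpars
  have hnn : 0 ≤ ∫ x, ‖φ x‖ ^ 2 * Real.exp (-b * ‖x‖ ^ 2) :=
    integral_nonneg fun x => by positivity
  have hc : 0 ≤ (π / b) ^ (3 / 2 : ℝ) := by positivity
  calc ∫⁻ x, ENNReal.ofReal (‖φ x‖ ^ 2 * Real.exp (-b * ‖x‖ ^ 2))
      = ENNReal.ofReal (∫ x, ‖φ x‖ ^ 2 * Real.exp (-b * ‖x‖ ^ 2)) :=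
        (ofReal_integral_eq_lintegral_ofReal hsq (.of_forall fun x => by positivity)).symm
    _ = ‖∫ p, u p * 𝓕⁻ g p‖ₑ := by
        rw [← hpars, ← ofReal_norm, Complex.norm_real, Real.norm_of_nonneg hnn]
    _ ≤ ∫⁻ p, ‖u p * 𝓕⁻ g p‖ₑ := enorm_integral_le_lintegral_enorm _
    _ ≤ _ := by
        refine lintegral_mono fun p => ?_
        rw [hinv, enorm_mul, ← ofReal_norm ((starRingEnd ℂ) _), RCLike.norm_conj, ofReal_norm,
          enorm_mul]
        calc _ ≤ ‖u p‖ₑ * (‖(((π / b) ^ (3 / 2 : ℝ) : ℝ) : ℂ)‖ₑ *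
              ∫⁻ q, ‖u q * Complex.exp (-π ^ 2 * ‖q - p‖ ^ 2 / b)‖ₑ) := by
              gcongr
              exact enorm_integral_le_lintegral_enorm _
          _ = _ := by
              rw [← lintegral_const_mul' _ _ enorm_ne_top, ← lintegral_const_mul' _ _ enorm_ne_top]
              congr 1
              ext q
              rw [← enorm_mul, ← enorm_mul, ← ofReal_norm]
              congr 1
              simp only [norm_mul, Complex.norm_real, Real.norm_of_nonneg hc, Complex.norm_exp]
              have : (-(π : ℂ) ^ 2 * ‖q - p‖ ^ 2 / b) =
                  ((-π ^ 2 * ‖q - p‖ ^ 2 / b : ℝ) : ℂ) := by push_cast; rfl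
              rw [this, Complex.ofReal_re, norm_sub_rev q p]
              ring

theorem lintegral_Ioi_mul_exp_neg {a c : ℝ} (ha : 0 ≤ a) (hc : 0 < c) :
    ∫⁻ s in Set.Ioi (0 : ℝ), ENNReal.ofReal (a * Real.exp (-c * s)) = ENNReal.ofReal (a / c) := by
  rw [← ofReal_integral_eq_lintegral_ofReal ((exp_neg_integrableOn_Ioi 0 hc).const_mul a)
    (.of_forall fun s => by positivity), integral_const_mul, integral_exp_mul_Ioi (by linarith)]
  congr 1
  simp
  field_simp

theorem lintegral_Ioi_mul_exp_mul_rpow {a lam r : ℝ} (ha : 0 ≤ a) (hlam : 0 < lam) (hr : 0 < r) :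
    ∫⁻ s in Set.Ioi (0 : ℝ), ENNReal.ofReal (a * (Real.exp (-lam * s) *
      (s ^ (-(3 / 2) : ℝ) * Real.exp (-(r ^ 2 / 4) / s)))) =
      ENNReal.ofReal (a * (2 * √π * (Real.exp (-(√lam * r)) / r))) := by
  rw [← ofReal_integral_eq_lintegral_ofReal
    ((integrableOn_exp_mul_rpow hlam (by positivity)).const_mul a) ?_, integral_const_mul,
    integral_exp_mul_rpow hlam hr]
  filter_upwards [ae_restrict_mem measurableSet_Ioi] with s (hs : 0 < s)
  positivity

theorem ae_fst_ne_snd : ∀ᵐ z : E3 × E3, z.1 ≠ z.2 := by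
  have h := (quasiMeasurePreserving_sub (volume : Measure E3) volume).ae
    (Measure.ae_ne volume (0 : E3))
  filter_upwards [h] with z hz
  exact fun h => hz (sub_eq_zero.2 h)

theorem singularIntegrand_nonneg (lam : ℝ) (φ : Lp ℂ 2 (volume : Measure E3)) (x : E3) :
    0 ≤ singularIntegrand lam φ x := by
  unfold singularIntegrand
  positivity

theorem aemeasurable_singularIntegrand (lam : ℝ) (φ : Lp ℂ 2 (volume : Measure E3)) :
    AEMeasurable (singularIntegrand lam φ) := by
  have hφm := (Lp.aestronglyMeasurable φ).aemeasurable
  unfold singularIntegrand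
  fun_prop

/-- A form of the Hardy-Kato inequality. -/
theorem integrable_singularIntegrand {φ : Lp ℂ 2 (volume : Measure E3)}
    (h : Integrable fun p => ‖p‖ * ‖(𝓕 φ : Lp ℂ 2 (volume : Measure E3)) p‖ ^ 2)
    {lam : ℝ} (hlam : 0 < lam) : Integrable (singularIntegrand lam φ) := by
  set u : E3 → ℂ := ⇑(𝓕 φ : Lp ℂ 2 (volume : Measure E3)) with hu
  have hum : AEStronglyMeasurable u := Lp.aestronglyMeasurable _
  have hφm := (Lp.aestronglyMeasurable φ).aemeasurable
  have hK := integrable_norm_mul_norm_mul_inv_sq_norm_sub hum h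
  -- The factor 2√π is the one produced by writing the Yukawa potential as an integral of Gaussians
  -- in s. Working with nonnegative integrals lets Tonelli apply before integrability is known.
  suffices hfin : ∫⁻ x, ENNReal.ofReal (2 * √π * singularIntegrand lam φ x) < ⊤ by
    have h1 : Integrable (fun x => 2 * √π * singularIntegrand lam φ x) := by
      have := aemeasurable_singularIntegrand lam φ
      refine ⟨AEMeasurable.aestronglyMeasurable (by fun_prop), ?_⟩
      rwa [hasFiniteIntegral_iff_ofReal (.of_forall fun x =>
        mul_nonneg (by positivity) (singularIntegrand_nonneg lam φ x))]
    exact (integrable_const_mul_iff (IsUnit.mk0 _ (by positivity)) _).1 h1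
  set c : ℝ := (4 * π) ^ (3 / 2 : ℝ) with hc
  have hc0 : 0 ≤ c := by positivity
  have hu1 : AEMeasurable (fun w : ℝ × (E3 × E3) => u w.2.1)
      ((volume.restrict (Set.Ioi 0)).prod volume) := by
    have : AEStronglyMeasurable (fun z : E3 × E3 => u z.1) volume := hum.comp_fst
    exact this.comp_snd.aemeasurable
  have hu2 : AEMeasurable (fun w : ℝ × (E3 × E3) => u w.2.2)
      ((volume.restrict (Set.Ioi 0)).prod volume) := by
    have : AEStronglyMeasurable (fun z : E3 × E3 => u z.2) volume := hum.comp_snd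
    exact this.comp_snd.aemeasurable
  have hu1' : AEMeasurable (fun z : E3 × E3 => u z.1) (volume.prod volume) := hum.comp_fst.aemeasurable
  have hu2' : AEMeasurable (fun z : E3 × E3 => u z.2) (volume.prod volume) := hum.comp_snd.aemeasurable
  have hφ1 : AEMeasurable (fun w : E3 × ℝ => φ w.1)
      (volume.prod (volume.restrict (Set.Ioi 0))) :=
    (Lp.aestronglyMeasurable φ).comp_fst.aemeasurable
  calc ∫⁻ x, ENNReal.ofReal (2 * √π * singularIntegrand lam φ x)
      = ∫⁻ x, ∫⁻ s in Set.Ioi (0 : ℝ), ENNReal.ofReal (‖φ x‖ ^ 2 * (Real.exp (-lam * s) *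
          (s ^ (-(3 / 2) : ℝ) * Real.exp (-(‖x‖ ^ 2 / 4) / s)))) := by
        refine lintegral_congr_ae ?_
        filter_upwards [Measure.ae_ne volume (0 : E3)] with x hx
        rw [lintegral_Ioi_mul_exp_mul_rpow (by positivity) hlam (norm_pos_iff.2 hx),
          singularIntegrand]
        congr 1
        ring
    _ = ∫⁻ s in Set.Ioi (0 : ℝ), ∫⁻ x, ENNReal.ofReal (‖φ x‖ ^ 2 * (Real.exp (-lam * s) *
          (s ^ (-(3 / 2) : ℝ) * Real.exp (-(‖x‖ ^ 2 / 4) / s)))) :=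
        lintegral_lintegral_swap (by unfold Function.uncurry; fun_prop)
    _ ≤ ∫⁻ s in Set.Ioi (0 : ℝ), ∫⁻ z : E3 × E3, ENNReal.ofReal
          (c * (‖u z.1‖ * ‖u z.2‖) * Real.exp (-(lam + 4 * π ^ 2 * ‖z.1 - z.2‖ ^ 2) * s)) := by
        refine setLIntegral_mono' measurableSet_Ioi fun s (hs : 0 < s) => ?_
        rw [Measure.volume_eq_prod, lintegral_prod _ (by fun_prop)]
        have e0 : 0 ≤ Real.exp (-lam * s) * s ^ (-(3 / 2) : ℝ) := by positivity
        have e1 : ∀ x : E3, ENNReal.ofReal (‖φ x‖ ^ 2 * (Real.exp (-lam * s) *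
            (s ^ (-(3 / 2) : ℝ) * Real.exp (-(‖x‖ ^ 2 / 4) / s)))) =
            ENNReal.ofReal (Real.exp (-lam * s) * s ^ (-(3 / 2) : ℝ)) *
            ENNReal.ofReal (‖φ x‖ ^ 2 * Real.exp (-(1 / (4 * s)) * ‖x‖ ^ 2)) := by
          intro x
          rw [← ENNReal.ofReal_mul e0]
          congr 1
          rw [show -(‖x‖ ^ 2 / 4) / s = -(1 / (4 * s)) * ‖x‖ ^ 2 by field_simp]
          ring
        simp only [e1]
        rw [lintegral_const_mul' _ _ ENNReal.ofReal_ne_top]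
        refine (mul_le_mul_right (lintegral_sq_norm_mul_gaussian_le φ
          (b := 1 / (4 * s)) (by positivity)) _).trans (le_of_eq ?_)
        rw [← lintegral_const_mul' _ _ ENNReal.ofReal_ne_top]
        congr 1
        ext p
        rw [← lintegral_const_mul' _ _ ENNReal.ofReal_ne_top]
        congr 1
        ext q
        rw [← ENNReal.ofReal_mul e0]
        congr 1
        -- The power s^{3/2} from the Gaussian transform cancels the weight s^{-3/2}, so only a pure
        -- exponential in s remains to integrate.
        have e2 : (π / (1 / (4 * s))) ^ (3 / 2 : ℝ) = c * s ^ (3 / 2 : ℝ) := by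
          rw [hc, ← Real.mul_rpow (by positivity) hs.le]
          congr 1
          field_simp
        have e3 : s ^ (-(3 / 2) : ℝ) * s ^ (3 / 2 : ℝ) = 1 := by
          rw [← Real.rpow_add hs]; norm_num
        have e4 : Real.exp (-(lam + 4 * π ^ 2 * ‖p - q‖ ^ 2) * s) =
            Real.exp (-lam * s) * Real.exp (-π ^ 2 * ‖p - q‖ ^ 2 / (1 / (4 * s))) := by
          rw [← Real.exp_add]
          congr 1
          field_simp
          ring
        rw [e2, e4]
        calc _ = (s ^ (-(3 / 2) : ℝ) * s ^ (3 / 2 : ℝ)) * (c * (‖u p‖ * ‖u q‖) *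
              (Real.exp (-lam * s) * Real.exp (-π ^ 2 * ‖p - q‖ ^ 2 / (1 / (4 * s))))) := by ring
          _ = _ := by rw [e3, one_mul]
    _ = ∫⁻ z : E3 × E3, ∫⁻ s in Set.Ioi (0 : ℝ), ENNReal.ofReal
          (c * (‖u z.1‖ * ‖u z.2‖) * Real.exp (-(lam + 4 * π ^ 2 * ‖z.1 - z.2‖ ^ 2) * s)) :=
        lintegral_lintegral_swap (by unfold Function.uncurry; fun_prop)
    _ ≤ ∫⁻ z : E3 × E3, ENNReal.ofReal (c / (4 * π ^ 2) *
          (‖u z.1‖ * ‖u z.2‖ * (‖z.1 - z.2‖ ^ 2)⁻¹)) := by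
        refine lintegral_mono_ae ?_
        filter_upwards [ae_fst_ne_snd] with z hz
        have hz' : 0 < ‖z.1 - z.2‖ := norm_pos_iff.2 (sub_ne_zero.2 hz)
        rw [lintegral_Ioi_mul_exp_neg (by positivity) (by positivity)]
        refine ENNReal.ofReal_le_ofReal ?_
        calc c * (‖u z.1‖ * ‖u z.2‖) / (lam + 4 * π ^ 2 * ‖z.1 - z.2‖ ^ 2)
            ≤ c * (‖u z.1‖ * ‖u z.2‖) / (4 * π ^ 2 * ‖z.1 - z.2‖ ^ 2) := by
              gcongr
              linarith
          _ = _ := by field_simp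
    _ < ⊤ := (hK.const_mul _).lintegral_lt_top

/-! ### The subordinated kernel in position space and its marginal. -/

/-- The subordinated Gaussian kernel `e^{-lam s} s^{-3} e^{-(x² + y² + x·y) / (3 s)}`. -/
noncomputable def heatKernel (lam : ℝ) (z : E3 × E3) (s : ℝ) : ℝ :=
  Real.exp (-lam * s) * ((s ^ 3)⁻¹ * Real.exp (-(quadD z / 3) / s))

theorem heatKernel_nonneg (lam : ℝ) (z : E3 × E3) {s : ℝ} (hs : 0 < s) :
    0 ≤ heatKernel lam z s := by
  unfold heatKernel
  positivity

theorem measurable_heatKernel (lam : ℝ) :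
    Measurable fun w : (E3 × E3) × ℝ => heatKernel lam w.1 w.2 := by
  have := continuous_quadD.measurable
  unfold heatKernel
  fun_prop

theorem heatKernel_swap (lam : ℝ) (z : E3 × E3) (s : ℝ) :
    heatKernel lam z.swap s = heatKernel lam z s := by
  simp only [heatKernel, quadD_swap]

/-- Completing the square in y leaves e^{-|x|²/(4s)} and a Gaussian of mass (3πs)^{3/2}, which
lowers s⁻³ to s^{-3/2}. -/
theorem lintegral_heatKernel_snd {a lam s : ℝ} (ha : 0 ≤ a) (hs : 0 < s) (x : E3) :
    ∫⁻ y, ENNReal.ofReal (a * heatKernel lam (x, y) s) =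
      ENNReal.ofReal ((3 * π) ^ (3 / 2 : ℝ) * a * (Real.exp (-lam * s) *
        (s ^ (-(3 / 2) : ℝ) * Real.exp (-(‖x‖ ^ 2 / 4) / s)))) := by
  have hb : 0 < 1 / (3 * s) := by positivity
  have hint : Integrable (fun y : E3 => Real.exp (-(1 / (3 * s)) * ‖y‖ ^ 2)) := by
    refine (integrable_gaussian_phase (V := E3) hb 0 0).norm.congr (.of_forall fun y => ?_)
    have h := norm_gaussian_phase (1 / (3 * s)) 0 0 y
    simp only [sub_zero] at h ⊢
    exact h
  have hval := GaussianFourier.integral_rexp_neg_mul_sq_norm (V := E3) hb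
  have hk : ∀ y, a * heatKernel lam (x, y) s =
      a * (Real.exp (-lam * s) * ((s ^ 3)⁻¹ * Real.exp (-(‖x‖ ^ 2 / 4) / s))) *
        Real.exp (-(1 / (3 * s)) * ‖y - (-(1 / 2 : ℝ) • x)‖ ^ 2) := by
    intro y
    rw [heatKernel, quadD_eq_norm_sub, mul_assoc a, mul_assoc (Real.exp _), mul_assoc ((s ^ 3)⁻¹),
      ← Real.exp_add]
    congr 5
    field_simp
    ring
  simp only [hk]
  rw [← ofReal_integral_eq_lintegral_ofReal ((hint.comp_sub_right _).const_mul _)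
    (.of_forall fun y => by positivity), integral_const_mul,
    integral_sub_right_eq_self (fun y : E3 => Real.exp (-(1 / (3 * s)) * ‖y‖ ^ 2)), hval]
  congr 1
  have e1 : (π / (1 / (3 * s))) ^ ((Module.finrank ℝ E3 : ℝ) / 2) =
      (3 * π) ^ (3 / 2 : ℝ) * s ^ (3 / 2 : ℝ) := by
    rw [← Real.mul_rpow (by positivity) hs.le]
    rw [one_div, div_inv_eq_mul, finrank_euclideanSpace_fin]
    push_cast
    ring_nf
  have e2 : (s ^ 3)⁻¹ * s ^ (3 / 2 : ℝ) = s ^ (-(3 / 2) : ℝ) := by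
    rw [← Real.rpow_natCast, ← Real.rpow_neg hs.le, ← Real.rpow_add hs]
    norm_num
  rw [e1, ← e2]
  ring

theorem three_pi_rpow : (3 * π) ^ (3 / 2 : ℝ) * (2 * √π) = 6 * √3 * π ^ 2 := by
  rw [show (3 / 2 : ℝ) = 1 + 1 / 2 by norm_num, Real.rpow_add (by positivity), Real.rpow_one,
    ← Real.sqrt_eq_rpow, Real.sqrt_mul (by norm_num)]
  linear_combination 6 * √3 * π * Real.mul_self_sqrt Real.pi_pos.le

/-- By Tonelli the y-marginal is computed first and the s-integral then gives the Yukawa potential.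
Stated for nonnegative integrals, it serves both for integrability and for the value. -/
theorem lintegral_sq_norm_mul_heatKernel (φ : Lp ℂ 2 (volume : Measure E3)) {lam : ℝ}
    (hlam : 0 < lam) :
    ∫⁻ w, ENNReal.ofReal (‖φ w.1.1‖ ^ 2 * heatKernel lam w.1 w.2)
      ∂((volume : Measure (E3 × E3)).prod (volume.restrict (Set.Ioi (0 : ℝ)))) =
      ∫⁻ x, ENNReal.ofReal (6 * √3 * π ^ 2 * singularIntegrand lam φ x) := by
  have hφm := (Lp.aestronglyMeasurable φ)
  have hφ1 : AEStronglyMeasurable (fun z : E3 × E3 => φ z.1) volume := hφm.comp_fst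
  have hφ1' : AEMeasurable (fun w : (E3 × E3) × ℝ => φ w.1.1)
      ((volume : Measure (E3 × E3)).prod (volume.restrict (Set.Ioi (0 : ℝ)))) :=
    hφ1.comp_fst.aemeasurable
  have hk := measurable_heatKernel lam
  have hm : AEMeasurable (fun w : (E3 × E3) × ℝ =>
      ENNReal.ofReal (‖φ w.1.1‖ ^ 2 * heatKernel lam w.1 w.2))
      ((volume : Measure (E3 × E3)).prod (volume.restrict (Set.Ioi (0 : ℝ)))) := by fun_prop
  rw [lintegral_prod _ hm, Measure.volume_eq_prod, lintegral_prod _ hm.lintegral_prod_right']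
  refine lintegral_congr_ae ?_
  filter_upwards [Measure.ae_ne volume (0 : E3)] with x hx
  calc ∫⁻ y, ∫⁻ s in Set.Ioi (0 : ℝ), ENNReal.ofReal (‖φ x‖ ^ 2 * heatKernel lam (x, y) s)
      = ∫⁻ s in Set.Ioi (0 : ℝ), ∫⁻ y, ENNReal.ofReal (‖φ x‖ ^ 2 * heatKernel lam (x, y) s) := by
        have hk' : Measurable fun w : E3 × ℝ => heatKernel lam (x, w.1) w.2 :=
          hk.comp (by fun_prop : Measurable fun w : E3 × ℝ => ((x, w.1), w.2))
        exact lintegral_lintegral_swap (by unfold Function.uncurry; fun_prop)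
    _ = ∫⁻ s in Set.Ioi (0 : ℝ), ENNReal.ofReal ((3 * π) ^ (3 / 2 : ℝ) * ‖φ x‖ ^ 2 *
          (Real.exp (-lam * s) * (s ^ (-(3 / 2) : ℝ) * Real.exp (-(‖x‖ ^ 2 / 4) / s)))) :=
        setLIntegral_congr_fun measurableSet_Ioi fun s (hs : 0 < s) =>
          lintegral_heatKernel_snd (by positivity) hs x
    _ = _ := by
        rw [lintegral_Ioi_mul_exp_mul_rpow (by positivity) hlam (norm_pos_iff.2 hx),
          ← three_pi_rpow, singularIntegrand]
        congr 1
        ring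

/-! ### Fourier exchange of the two-variable Gaussians. -/

theorem memLp_gaussian {b : ℝ} (hb : 0 < b) : MemLp (fun x : E3 => Real.exp (-b * ‖x‖ ^ 2)) 2 := by
  refine (memLp_gaussian_phase (V := E3) hb 0 0).norm.ae_eq (.of_forall fun x => ?_)
  have h := norm_gaussian_phase b 0 0 x
  simp only [sub_zero] at h ⊢
  exact h

theorem integrable_conj_mul_gaussian_quadD {f : E3 → ℂ} (hf : MemLp f 2) {b : ℝ} (hb : 0 < b) :
    Integrable (fun z : E3 × E3 =>
      (starRingEnd ℂ) (f z.1) * f z.2 * ((Real.exp (-b * quadD z) : ℝ) : ℂ)) := by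
  have hg : Integrable (fun x : E3 => ‖f x‖ * Real.exp (-(b / 2) * ‖x‖ ^ 2)) :=
    hf.norm.integrable_mul (memLp_gaussian (by positivity))
  have h1 : AEStronglyMeasurable (fun z : E3 × E3 => f z.1) := hf.1.comp_fst
  have h2 : AEStronglyMeasurable (fun z : E3 × E3 => f z.2) := hf.1.comp_snd
  have hq := continuous_quadD
  refine (hg.mul_prod hg).mono' ((h1.star.mul h2).mul (by fun_prop)) (.of_forall fun z => ?_)
  simp only [norm_mul, RCLike.norm_conj, Complex.norm_real, Real.norm_eq_abs, Real.abs_exp]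
  rw [mul_mul_mul_comm, ← Real.exp_add]
  gcongr
  nlinarith [half_add_le_quadD z]

/-- The Fourier transform exchanges the Gaussians of the quadratic form `x² + y² + x·y`. -/
theorem integral_conj_mul_gaussian_quadD (φ : Lp ℂ 2 (volume : Measure E3)) {s : ℝ}
    (hs : 0 < s) :
    ∫ z : E3 × E3, (starRingEnd ℂ) (φ z.1) * φ z.2 *
        ((Real.exp (-(1 / (3 * s)) * quadD z) : ℝ) : ℂ) =
      ((24 * √3 * π ^ 3 * s ^ 3 : ℝ) : ℂ) * ∫ z : E3 × E3,
        (starRingEnd ℂ) ((𝓕 φ : Lp ℂ 2 (volume : Measure E3)) z.1) *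
          (𝓕 φ : Lp ℂ 2 (volume : Measure E3)) z.2 *
          ((Real.exp (-(4 * π ^ 2 * s) * quadD z) : ℝ) : ℂ) := by
  set u : E3 → ℂ := ⇑(𝓕 φ : Lp ℂ 2 (volume : Measure E3)) with hu
  have huL : MemLp u 2 := Lp.memLp _
  have hφL : MemLp φ 2 := Lp.memLp _
  set c1 : ℝ := (π / (1 / (3 * s))) ^ (3 / 2 : ℝ) with hc1
  set c2 : ℝ := (π / (1 / (4 * s))) ^ (3 / 2 : ℝ) with hc2
  have hc : c1 * c2 = 24 * √3 * π ^ 3 * s ^ 3 := by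
    rw [hc1, hc2, ← Real.mul_rpow (by positivity) (by positivity),
      show π / (1 / (3 * s)) * (π / (1 / (4 * s))) = (2 * π * s) ^ 2 * 3 by field_simp; norm_num,
      Real.mul_rpow (by positivity) (by positivity), ← Real.rpow_natCast (2 * π * s),
      ← Real.rpow_mul (by positivity), show ((2 : ℕ) : ℝ) * (3 / 2) = (3 : ℕ) by norm_num,
      Real.rpow_natCast, show (3 / 2 : ℝ) = 1 + 1 / 2 by norm_num, Real.rpow_add (by norm_num),
      Real.rpow_one, ← Real.sqrt_eq_rpow]
    ring
  -- The half-transformed integrand, in position x and momentum q. Completing the square in y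
  -- centres a Gaussian at -x/2, hence the phase e^{-iπ x·q}; read as a function of x, that phase is
  -- a modulation by q/2, which completes the square on the momentum side.
  set A : E3 → E3 → ℂ := fun x q => (starRingEnd ℂ) (φ x) *
    ((Real.exp (-(1 / (4 * s)) * ‖x‖ ^ 2) : ℝ) : ℂ) *
      (u q * ((Real.exp (-(3 * π ^ 2 * s) * ‖q‖ ^ 2) : ℝ) : ℂ)) *
        Complex.exp (-(π * inner ℝ x q * Complex.I)) with hA
  have hgauss : ∀ b : ℝ, 0 < b → MemLp (fun x : E3 => ((Real.exp (-b * ‖x‖ ^ 2) : ℝ) : ℂ)) 2 := by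
    exact fun b hb => (memLp_gaussian hb).ofReal
  have hAint : Integrable (Function.uncurry A) := by
    have h1 : Integrable (fun x => (starRingEnd ℂ) (φ x) *
        ((Real.exp (-(1 / (4 * s)) * ‖x‖ ^ 2) : ℝ) : ℂ)) :=
      hφL.star.integrable_mul (hgauss _ (by positivity))
    have h2 : Integrable (fun q => u q * ((Real.exp (-(3 * π ^ 2 * s) * ‖q‖ ^ 2) : ℝ) : ℂ)) :=
      huL.integrable_mul (hgauss _ (by positivity))
    refine (h1.mul_prod h2).mul_bdd (c := 1) (by fun_prop) (.of_forall fun z => ?_)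
    rw [← neg_mul, ← Complex.ofReal_mul, ← Complex.ofReal_neg, Complex.norm_exp_ofReal_mul_I]
  have hinner : ∀ x, ∫ y, (starRingEnd ℂ) (φ x) * φ y *
      ((Real.exp (-(1 / (3 * s)) * quadD (x, y)) : ℝ) : ℂ) = c1 * ∫ q, A x q := by
    intro x
    have h := integral_mul_gaussian_phase_three φ (b := 1 / (3 * s)) (by positivity)
      (-(1 / 2 : ℝ) • x) 0
    calc _ = ((starRingEnd ℂ) (φ x) * ((Real.exp (-(1 / (4 * s)) * ‖x‖ ^ 2) : ℝ) : ℂ)) *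
          ∫ y, φ y * Complex.exp (-((1 / (3 * s) : ℝ) : ℂ) * ‖y - (-(1 / 2 : ℝ) • x)‖ ^ 2 +
            2 * π * Complex.I * inner ℝ 0 y) := by
          rw [← integral_const_mul]
          congr 1
          ext y
          have e : Real.exp (-(1 / (3 * s)) * quadD (x, y)) =
              Real.exp (-(1 / (4 * s)) * ‖x‖ ^ 2) *
                Real.exp (-(1 / (3 * s)) * ‖y - (-(1 / 2 : ℝ) • x)‖ ^ 2) := by
            rw [← Real.exp_add, quadD_eq_norm_sub]
            congr 1
            field_simp
            ring
          rw [e]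
          simp only [inner_zero_left, Complex.ofReal_zero, mul_zero, add_zero]
          push_cast
          ring
      _ = _ := by
          rw [h, ← hc1, mul_left_comm, ← integral_const_mul]
          congr 2
          ext q
          simp only [hA, add_zero, Complex.exp_add, inner_smul_left]
          have e1 : Complex.exp (-(π : ℂ) ^ 2 * ‖q‖ ^ 2 / ((1 / (3 * s) : ℝ) : ℂ)) =
              ((Real.exp (-(3 * π ^ 2 * s) * ‖q‖ ^ 2) : ℝ) : ℂ) := by
            rw [Complex.ofReal_exp]
            congr 1
            push_cast
            rw [one_div, div_inv_eq_mul]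
            ring
          rw [e1]
          have e2 : Complex.exp (2 * π * Complex.I *
              (((starRingEnd ℝ) (-(1 / 2 : ℝ)) * inner ℝ x q : ℝ) : ℂ)) =
              Complex.exp (-(π * inner ℝ x q * Complex.I)) := by
            congr 1
            simp
            ring
          rw [e2]
          ring
  have houter : ∀ q, ∫ x, A x q = c2 * ∫ p, (starRingEnd ℂ) (u p) * u q *
      ((Real.exp (-(4 * π ^ 2 * s) * quadD (p, q)) : ℝ) : ℂ) := by
    intro q
    have h := integral_mul_gaussian_phase_three φ (b := 1 / (4 * s)) (by positivity) 0
      ((1 / 2 : ℝ) • q)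
    have hc2' : (starRingEnd ℂ) 2 = 2 := Complex.conj_ofReal 2
    calc _ = (u q * ((Real.exp (-(3 * π ^ 2 * s) * ‖q‖ ^ 2) : ℝ) : ℂ)) * (starRingEnd ℂ)
          (∫ x, φ x * Complex.exp (-((1 / (4 * s) : ℝ) : ℂ) * ‖x - 0‖ ^ 2 +
            2 * π * Complex.I * inner ℝ ((1 / 2 : ℝ) • q) x)) := by
          rw [← integral_conj, ← integral_const_mul]
          congr 1
          ext x
          simp only [hA, sub_zero, map_mul, ← Complex.exp_conj, map_neg, map_pow,
            Complex.conj_ofReal, Complex.conj_I, hc2', Complex.exp_add, inner_smul_left]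
          have e2 : Complex.exp (2 * π * -Complex.I *
              (((starRingEnd ℝ) (1 / 2 : ℝ) * inner ℝ q x : ℝ) : ℂ)) =
              Complex.exp (-(π * inner ℝ x q * Complex.I)) := by
            congr 1
            rw [real_inner_comm]
            simp
            ring
          rw [e2]
          push_cast
          ring
      _ = _ := by
          rw [h, ← hc2, map_mul, Complex.conj_ofReal, mul_left_comm, ← integral_conj,
            ← integral_const_mul]
          congr 2
          ext p
          have e1 : (-(π : ℂ) ^ 2 * ‖p + (1 / 2 : ℝ) • q‖ ^ 2 / ((1 / (4 * s) : ℝ) : ℂ) +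
              2 * π * Complex.I * (inner ℝ (0 : E3) (p + (1 / 2 : ℝ) • q) : ℝ)) =
              ((-(4 * π ^ 2 * s) * ‖p + (1 / 2 : ℝ) • q‖ ^ 2 : ℝ) : ℂ) := by
            rw [inner_zero_left]
            push_cast
            rw [div_div_eq_mul_div, div_one]
            ring
          have e2 : Real.exp (-(4 * π ^ 2 * s) * quadD (p, q)) =
              Real.exp (-(3 * π ^ 2 * s) * ‖q‖ ^ 2) *
                Real.exp (-(4 * π ^ 2 * s) * ‖p + (1 / 2 : ℝ) • q‖ ^ 2) := by
            rw [← Real.exp_add, norm_add_sq_real, quadD, inner_smul_right, norm_smul, mul_pow]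
            congr 1
            norm_num
            ring
          rw [e1, e2, ← Complex.ofReal_exp, map_mul, Complex.conj_ofReal]
          push_cast
          ring
  rw [Measure.volume_eq_prod, integral_prod _ (integrable_conj_mul_gaussian_quadD hφL
    (by positivity)), integral_prod_symm _ (integrable_conj_mul_gaussian_quadD huL
    (by positivity)), ← hc]
  simp only [hinner]
  rw [integral_const_mul, integral_integral_swap hAint]
  simp only [houter]
  rw [integral_const_mul]
  push_cast
  ring

/-! ### Integration in s: from heat kernels to the resolvent kernel. -/

theorem ae_prod_Ioi_pos : ∀ᵐ w : (E3 × E3) × ℝ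
    ∂((volume : Measure (E3 × E3)).prod (volume.restrict (Set.Ioi (0 : ℝ)))), 0 < w.2 :=
  Measure.quasiMeasurePreserving_snd.ae (ae_restrict_mem measurableSet_Ioi)

theorem integrable_sq_norm_mul_heatKernel {φ : Lp ℂ 2 (volume : Measure E3)} {lam : ℝ}
    (hlam : 0 < lam) (h : Integrable (singularIntegrand lam φ)) :
    Integrable (fun w : (E3 × E3) × ℝ => ‖φ w.1.1‖ ^ 2 * heatKernel lam w.1 w.2)
      ((volume : Measure (E3 × E3)).prod (volume.restrict (Set.Ioi (0 : ℝ)))) := by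
  have hφ1 : AEStronglyMeasurable (fun z : E3 × E3 => φ z.1) volume :=
    (Lp.aestronglyMeasurable φ).comp_fst
  have hφ1' : AEMeasurable (fun w : (E3 × E3) × ℝ => φ w.1.1)
      ((volume : Measure (E3 × E3)).prod (volume.restrict (Set.Ioi (0 : ℝ)))) :=
    hφ1.comp_fst.aemeasurable
  have hk := measurable_heatKernel lam
  refine ⟨AEMeasurable.aestronglyMeasurable (by fun_prop), ?_⟩
  rw [hasFiniteIntegral_iff_ofReal, lintegral_sq_norm_mul_heatKernel φ hlam]
  · exact (h.const_mul _).lintegral_lt_top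
  · filter_upwards [ae_prod_Ioi_pos] with w hw
    have := heatKernel_nonneg lam w.1 hw
    simp only [Pi.zero_apply]
    positivity

/-- Dominated by |φ(x)|² plus |φ(y)|² times the kernel; the second term is integrable because the
kernel is symmetric under the swap of x and y. -/
theorem integrable_conj_mul_heatKernel {φ : Lp ℂ 2 (volume : Measure E3)} {lam : ℝ}
    (hlam : 0 < lam) (h : Integrable (singularIntegrand lam φ)) :
    Integrable (fun w : (E3 × E3) × ℝ =>
      (starRingEnd ℂ) (φ w.1.1) * φ w.1.2 * ((heatKernel lam w.1 w.2 : ℝ) : ℂ))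
      ((volume : Measure (E3 × E3)).prod (volume.restrict (Set.Ioi (0 : ℝ)))) := by
  have h1 := integrable_sq_norm_mul_heatKernel hlam h
  have hswap : MeasurePreserving (Prod.map Prod.swap id : (E3 × E3) × ℝ → (E3 × E3) × ℝ)
      ((volume : Measure (E3 × E3)).prod (volume.restrict (Set.Ioi (0 : ℝ))))
      ((volume : Measure (E3 × E3)).prod (volume.restrict (Set.Ioi (0 : ℝ)))) :=
    Measure.measurePreserving_swap.prod (MeasurePreserving.id _)
  have h2 := hswap.integrable_comp_of_integrable h1
  have hφ1 : AEStronglyMeasurable (fun z : E3 × E3 => φ z.1) volume :=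
    (Lp.aestronglyMeasurable φ).comp_fst
  have hφ2 : AEStronglyMeasurable (fun z : E3 × E3 => φ z.2) volume :=
    (Lp.aestronglyMeasurable φ).comp_snd
  have hk := measurable_heatKernel lam
  refine (h1.add h2).mono' ((hφ1.comp_fst.star.mul hφ2.comp_fst).mul (by fun_prop)) ?_
  filter_upwards [ae_prod_Ioi_pos] with w hw
  have hk0 := heatKernel_nonneg lam w.1 hw
  simp only [norm_mul, RCLike.norm_conj, Complex.norm_real, Real.norm_of_nonneg hk0, Pi.add_apply,
    Function.comp_apply, Prod.map_fst, Prod.map_snd, Prod.fst_swap, heatKernel_swap, id]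
  rw [← add_mul]
  gcongr
  nlinarith [sq_nonneg (‖φ w.1.1‖ - ‖φ w.1.2‖), sq_nonneg ‖φ w.1.1‖, sq_nonneg ‖φ w.1.2‖]

/-- The resolvent kernel `∫₀^∞ e^{-lam s} s^{-3} e^{-(x² + y² + x·y) / (3 s)} ds`. -/
noncomputable def resolventKernel (lam : ℝ) (z : E3 × E3) : ℝ :=
  ∫ s in Set.Ioi (0 : ℝ), heatKernel lam z s

theorem resolventKernel_eq_besselK {lam : ℝ} (hlam : 0 < lam) {z : E3 × E3} (hz : 0 < quadD z) :
    resolventKernel lam z = 6 * lam / quadD z * besselK 2 (√(4 * lam / 3) * √(quadD z)) :=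
  integral_exp_mul_inv_cube hlam hz

theorem resolventKernel_swap (lam : ℝ) (z : E3 × E3) :
    resolventKernel lam z.swap = resolventKernel lam z := by
  simp only [resolventKernel, heatKernel_swap]

theorem integrable_sq_norm_mul_resolventKernel {φ : Lp ℂ 2 (volume : Measure E3)} {lam : ℝ}
    (hlam : 0 < lam) (h : Integrable (singularIntegrand lam φ)) :
    Integrable (fun z : E3 × E3 => ‖φ z.1‖ ^ 2 * resolventKernel lam z) := by
  have h1 := (integrable_sq_norm_mul_heatKernel hlam h).integral_prod_left
  simp only [integral_const_mul] at h1
  exact h1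

theorem integral_sq_norm_mul_resolventKernel {φ : Lp ℂ 2 (volume : Measure E3)} {lam : ℝ}
    (hlam : 0 < lam) (h : Integrable (singularIntegrand lam φ)) :
    ∫ z : E3 × E3, ‖φ z.1‖ ^ 2 * resolventKernel lam z =
      6 * √3 * π ^ 2 * ∫ x, singularIntegrand lam φ x := by
  have h0 := integrable_sq_norm_mul_heatKernel hlam h
  have h1 := integral_prod _ h0
  simp only [integral_const_mul] at h1
  rw [← integral_const_mul]
  refine h1.symm.trans ?_
  rw [integral_eq_lintegral_of_nonneg_ae _ h0.1, lintegral_sq_norm_mul_heatKernel φ hlam,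
    integral_eq_lintegral_of_nonneg_ae
      (.of_forall fun x => mul_nonneg (by positivity) (singularIntegrand_nonneg lam φ x))
      (h.const_mul _).1]
  filter_upwards [ae_prod_Ioi_pos] with w hw
  have := heatKernel_nonneg lam w.1 hw
  simp only [Pi.zero_apply]
  positivity

theorem integrable_conj_mul_resolventKernel {φ : Lp ℂ 2 (volume : Measure E3)} {lam : ℝ}
    (hlam : 0 < lam) (h : Integrable (singularIntegrand lam φ)) :
    Integrable (fun z : E3 × E3 =>
      (starRingEnd ℂ) (φ z.1) * φ z.2 * ((resolventKernel lam z : ℝ) : ℂ)) := by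
  have h1 := (integrable_conj_mul_heatKernel hlam h).integral_prod_left
  simp only [integral_const_mul, integral_complex_ofReal] at h1
  exact h1

theorem integral_Ioi_exp_neg_mul {c : ℝ} (hc : 0 < c) :
    ∫ s in Set.Ioi (0 : ℝ), Real.exp (-c * s) = c⁻¹ := by
  rw [integral_exp_mul_Ioi (by linarith)]
  simp

theorem offDenominator_pos {lam : ℝ} (hlam : 0 < lam) (z : E3 × E3) :
    0 < 4 * π ^ 2 * quadD z + lam := by
  have hq := quadD_nonneg z
  positivity

theorem integrable_norm_mul_offDenominator_inv {u : E3 → ℂ} (hu : AEStronglyMeasurable u)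
    (h : Integrable fun p => ‖p‖ * ‖u p‖ ^ 2) {lam : ℝ} (hlam : 0 < lam) :
    Integrable (fun z : E3 × E3 => ‖u z.1‖ * ‖u z.2‖ * (4 * π ^ 2 * quadD z + lam)⁻¹) := by
  have h1 : AEMeasurable (fun z : E3 × E3 => u z.1) := hu.comp_fst.aemeasurable
  have h2 : AEMeasurable (fun z : E3 × E3 => u z.2) := hu.comp_snd.aemeasurable
  have hq := continuous_quadD.measurable
  refine ((integrable_norm_mul_norm_mul_inv_sq_norm_sub hu h).const_mul (π ^ 2)⁻¹).mono'
    (AEMeasurable.aestronglyMeasurable (by fun_prop)) ?_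
  filter_upwards [ae_fst_ne_snd] with z hz
  have hz' : 0 < ‖z.1 - z.2‖ := norm_pos_iff.2 (sub_ne_zero.2 hz)
  have hpos := offDenominator_pos hlam z
  rw [Real.norm_of_nonneg (by positivity), mul_left_comm, ← mul_inv]
  gcongr
  nlinarith [sq_norm_sub_le_four_mul_quadD z, Real.pi_pos, sq_nonneg π]

theorem integrable_conj_mul_exp {u : E3 → ℂ} (hu : AEStronglyMeasurable u)
    (h : Integrable fun p => ‖p‖ * ‖u p‖ ^ 2) {lam : ℝ} (hlam : 0 < lam) :
    Integrable (fun w : (E3 × E3) × ℝ => (starRingEnd ℂ) (u w.1.1) * u w.1.2 *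
      ((Real.exp (-(4 * π ^ 2 * quadD w.1 + lam) * w.2) : ℝ) : ℂ))
      ((volume : Measure (E3 × E3)).prod (volume.restrict (Set.Ioi (0 : ℝ)))) := by
  have h1 : AEStronglyMeasurable (fun z : E3 × E3 => u z.1) volume := hu.comp_fst
  have h2 : AEStronglyMeasurable (fun z : E3 × E3 => u z.2) volume := hu.comp_snd
  have hq := continuous_quadD.measurable
  have hexp : Measurable fun w : (E3 × E3) × ℝ =>
      ((Real.exp (-(4 * π ^ 2 * quadD w.1 + lam) * w.2) : ℝ) : ℂ) := by fun_prop
  have hm : AEStronglyMeasurable (fun w : (E3 × E3) × ℝ => (starRingEnd ℂ) (u w.1.1) * u w.1.2 *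
      ((Real.exp (-(4 * π ^ 2 * quadD w.1 + lam) * w.2) : ℝ) : ℂ))
      ((volume : Measure (E3 × E3)).prod (volume.restrict (Set.Ioi (0 : ℝ)))) :=
    (h1.comp_fst.star.mul h2.comp_fst).mul hexp.aestronglyMeasurable
  rw [integrable_prod_iff hm]
  refine ⟨.of_forall fun z => ?_, ?_⟩
  · exact (Integrable.ofReal (𝕜 := ℂ)
      (exp_neg_integrableOn_Ioi 0 (offDenominator_pos hlam z))).const_mul
        ((starRingEnd ℂ) (u z.1) * u z.2)
  · refine (integrable_norm_mul_offDenominator_inv hu h hlam).congr (.of_forall fun z => ?_)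
    simp only [norm_mul, RCLike.norm_conj, Complex.norm_real, Real.norm_eq_abs, Real.abs_exp]
    rw [integral_const_mul, integral_Ioi_exp_neg_mul (offDenominator_pos hlam z)]

/-- Fubini on both sides reduces the claim to the Gaussian exchange at fixed s, where the factor s³
cancels the s⁻³ of the kernel. -/
theorem integral_conj_mul_resolventKernel {φ : Lp ℂ 2 (volume : Measure E3)}
    (h : Integrable fun p => ‖p‖ * ‖(𝓕 φ : Lp ℂ 2 (volume : Measure E3)) p‖ ^ 2)
    {lam : ℝ} (hlam : 0 < lam) :
    ∫ z : E3 × E3, (starRingEnd ℂ) (φ z.1) * φ z.2 * ((resolventKernel lam z : ℝ) : ℂ) =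
      ((24 * √3 * π ^ 3 : ℝ) : ℂ) * ∫ z : E3 × E3,
        (starRingEnd ℂ) ((𝓕 φ : Lp ℂ 2 (volume : Measure E3)) z.1) *
          (𝓕 φ : Lp ℂ 2 (volume : Measure E3)) z.2 *
          (((4 * π ^ 2 * quadD z + lam)⁻¹ : ℝ) : ℂ) := by
  set u : E3 → ℂ := ⇑(𝓕 φ : Lp ℂ 2 (volume : Measure E3)) with hu
  have hum : AEStronglyMeasurable u := Lp.aestronglyMeasurable _
  have hs := integrable_singularIntegrand h hlam
  have hL := integral_prod_symm _ (integrable_conj_mul_heatKernel hlam hs)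
  rw [integral_prod _ (integrable_conj_mul_heatKernel hlam hs)] at hL
  have hR := integral_prod_symm _ (integrable_conj_mul_exp hum h hlam)
  rw [integral_prod _ (integrable_conj_mul_exp hum h hlam)] at hR
  simp only [integral_const_mul, integral_complex_ofReal, integral_Ioi_exp_neg_mul (offDenominator_pos hlam _)] at hL hR
  refine hL.trans ?_
  rw [hR, ← integral_const_mul]
  refine setIntegral_congr_fun measurableSet_Ioi fun s (hs : 0 < s) => ?_
  have hG := integral_conj_mul_gaussian_quadD φ hs
  calc ∫ z : E3 × E3, (starRingEnd ℂ) (φ z.1) * φ z.2 * ((heatKernel lam z s : ℝ) : ℂ)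
      = ((Real.exp (-lam * s) * (s ^ 3)⁻¹ : ℝ) : ℂ) *
          ∫ z : E3 × E3, (starRingEnd ℂ) (φ z.1) * φ z.2 *
        ((Real.exp (-(1 / (3 * s)) * quadD z) : ℝ) : ℂ) := by
        rw [← integral_const_mul]
        congr 1
        ext z
        rw [heatKernel, show -(quadD z / 3) / s = -(1 / (3 * s)) * quadD z by field_simp]
        push_cast
        ring
    _ = _ := by
        rw [hG, ← integral_const_mul, ← integral_const_mul, ← integral_const_mul]
        congr 1
        ext z
        rw [show -(4 * π ^ 2 * quadD z + lam) * s = -lam * s + -(4 * π ^ 2 * s) * quadD z by ring,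
          Real.exp_add]
        have hs' : (s : ℂ) ≠ 0 := by exact_mod_cast hs.ne'
        simp only [hu]
        push_cast
        field_simp

/-! ### Rescaling to the unitary Fourier convention. -/

theorem offIntegrand_eq (lam : ℝ) (φ : Lp ℂ 2 (volume : Measure E3)) (z : E3 × E3) :
    offIntegrand lam φ z = ((((2 * π) ^ 3)⁻¹ : ℝ) : ℂ) *
      (fun z : E3 × E3 => (starRingEnd ℂ) ((𝓕 φ : Lp ℂ 2 (volume : Measure E3)) z.1) *
          (𝓕 φ : Lp ℂ 2 (volume : Measure E3)) z.2 *
          (((4 * π ^ 2 * quadD z + lam)⁻¹ : ℝ) : ℂ)) ((2 * π)⁻¹ • z) := by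
  have hq : 4 * π ^ 2 * quadD ((2 * π)⁻¹ • z) = quadD z := by
    simp only [quadD, Prod.smul_fst, Prod.smul_snd, norm_smul, inner_smul_left, inner_smul_right,
      mul_pow, norm_inv, Real.norm_of_nonneg (show 0 ≤ 2 * π by positivity)]
    simp
    field_simp
    norm_num
  have hc : ((((2 * π) ^ (-(3 / 2 : ℝ)) : ℝ) : ℂ)) * (((2 * π) ^ (-(3 / 2 : ℝ)) : ℝ) : ℂ) =
      ((((2 * π) ^ 3)⁻¹ : ℝ) : ℂ) := by
    rw [← Complex.ofReal_mul, ← Real.rpow_add (by positivity), ← Real.rpow_natCast,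
      ← Real.rpow_neg (by positivity)]
    norm_num
  beta_reduce
  rw [offIntegrand, fourierHat, fourierHat, hq, ← hc, map_mul, Complex.conj_ofReal, div_eq_mul_inv,
    Complex.ofReal_inv, Prod.smul_fst, Prod.smul_snd]
  ring

instance isAddHaarMeasure_volume_prod : (volume : Measure (E3 × E3)).IsAddHaarMeasure := by
  rw [Measure.volume_eq_prod]
  infer_instance

theorem integrable_offIntegrand {φ : Lp ℂ 2 (volume : Measure E3)}
    (h : Integrable fun p => ‖p‖ * ‖(𝓕 φ : Lp ℂ 2 (volume : Measure E3)) p‖ ^ 2)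
    {lam : ℝ} (hlam : 0 < lam) : Integrable (offIntegrand lam φ) := by
  have h1 := (integrable_conj_mul_exp (Lp.aestronglyMeasurable _) h hlam).integral_prod_left
  simp only [integral_const_mul, integral_complex_ofReal,
    integral_Ioi_exp_neg_mul (offDenominator_pos hlam _)] at h1
  rw [funext (offIntegrand_eq lam φ)]
  exact (h1.comp_smul (inv_ne_zero (by positivity : 2 * π ≠ 0))).const_mul _

theorem integral_offIntegrand (lam : ℝ) (φ : Lp ℂ 2 (volume : Measure E3)) :
    ∫ z, offIntegrand lam φ z = (((2 * π) ^ 3 : ℝ) : ℂ) * ∫ z : E3 × E3,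
      (starRingEnd ℂ) ((𝓕 φ : Lp ℂ 2 (volume : Measure E3)) z.1) *
          (𝓕 φ : Lp ℂ 2 (volume : Measure E3)) z.2 *
          (((4 * π ^ 2 * quadD z + lam)⁻¹ : ℝ) : ℂ) := by
  simp only [offIntegrand_eq lam φ]
  rw [integral_const_mul]
  refine (congrArg _ (Measure.integral_comp_smul volume (fun z : E3 × E3 =>
    (starRingEnd ℂ) ((𝓕 φ : Lp ℂ 2 (volume : Measure E3)) z.1) *
      (𝓕 φ : Lp ℂ 2 (volume : Measure E3)) z.2 *
      (((4 * π ^ 2 * quadD z + lam)⁻¹ : ℝ) : ℂ)) (2 * π)⁻¹)).trans ?_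
  rw [Complex.real_smul, ← mul_assoc, ← Complex.ofReal_mul]
  congr 2
  -- The Jacobian (2π)⁶ meets the prefactor (2π)⁻³ of the two transforms, leaving (2π)³.
  have hd : Module.finrank ℝ (E3 × E3) = 6 := by simp
  rw [hd, abs_of_nonneg (by positivity), inv_pow, inv_inv]
  field_simp

/-! ### Polarisation and the final identity. -/

theorem besselK_nonneg (ν x : ℝ) : 0 ≤ besselK ν x :=
  integral_nonneg fun _ => mul_nonneg (Real.exp_pos _).le (Real.cosh_pos _).le

theorem differenceIntegrand_nonneg (lam : ℝ) (φ : Lp ℂ 2 (volume : Measure E3)) (z : E3 × E3) :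
    0 ≤ differenceIntegrand lam φ z :=
  mul_nonneg (div_nonneg (sq_nonneg _) (quadD_nonneg z)) (besselK_nonneg _ _)

theorem differenceIntegrand_eq {lam : ℝ} (hlam : 0 < lam) (φ : Lp ℂ 2 (volume : Measure E3))
    {z : E3 × E3} (hz : 0 < quadD z) :
    differenceIntegrand lam φ z = (6 * lam)⁻¹ * (‖φ z.1‖ ^ 2 * resolventKernel lam z +
      ‖φ z.2‖ ^ 2 * resolventKernel lam z -
      2 * ((starRingEnd ℂ) (φ z.1) * φ z.2 * ((resolventKernel lam z : ℝ) : ℂ)).re) := by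
  have h : ‖φ z.1 - φ z.2‖ ^ 2 =
      ‖φ z.1‖ ^ 2 + ‖φ z.2‖ ^ 2 - 2 * ((starRingEnd ℂ) (φ z.1) * φ z.2).re := by
    simp only [← Complex.normSq_eq_norm_sq, Complex.normSq_apply, Complex.sub_re, Complex.sub_im,
      Complex.mul_re, Complex.conj_re, Complex.conj_im]
    ring
  rw [Complex.re_mul_ofReal, differenceIntegrand, resolventKernel_eq_besselK hlam hz, h]
  field_simp

/-- The kernel is real and symmetric, so conjugation amounts to swapping x and y. The form is
therefore real, and the real part taken in the polarisation loses nothing. -/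
theorem conj_integral_conj_mul_resolventKernel (lam : ℝ) (φ : Lp ℂ 2 (volume : Measure E3)) :
    (starRingEnd ℂ) (∫ z : E3 × E3,
      (starRingEnd ℂ) (φ z.1) * φ z.2 * ((resolventKernel lam z : ℝ) : ℂ)) =
      ∫ z : E3 × E3, (starRingEnd ℂ) (φ z.1) * φ z.2 * ((resolventKernel lam z : ℝ) : ℂ) := by
  rw [← integral_conj, Measure.volume_eq_prod, ← integral_prod_swap]
  congr 1
  ext z
  simp only [map_mul, Complex.conj_conj, Complex.conj_ofReal, resolventKernel_swap, Prod.fst_swap,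
    Prod.snd_swap]
  ring

theorem proposition2 (φ : Lp ℂ 2 (volume : Measure E3))
    (hφ : TemperedDistribution.MemSobolev (1 / 2 : ℝ) 2 (Lp.toTemperedDistribution φ))
    (lam : ℝ) (hlam : 0 < lam) :
    Integrable (offIntegrand lam φ) ∧
    Integrable (singularIntegrand lam φ) ∧
    Integrable (differenceIntegrand lam φ) ∧
    phiOff lam φ =
      ((-24 * Real.pi * (∫ x : E3, singularIntegrand lam φ x) +
        4 * Real.sqrt 3 * lam / Real.pi *
          (∫ z : E3 × E3, differenceIntegrand lam φ z) : ℝ) : ℂ) ∧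
    -24 * Real.pi * (∫ x : E3, singularIntegrand lam φ x) ≤ 0 ∧
    0 ≤ 4 * Real.sqrt 3 * lam / Real.pi *
      (∫ z : E3 × E3, differenceIntegrand lam φ z) := by
  have h := integrable_norm_mul_sq_fourier_of_memSobolev hφ
  have hS := integrable_singularIntegrand h hlam
  have h1 := integrable_sq_norm_mul_resolventKernel hlam hS
  have h2 : Integrable (fun z : E3 × E3 => ‖φ z.2‖ ^ 2 * resolventKernel lam z) := by
    refine h1.swap.congr (.of_forall fun z => ?_)
    simp only [Function.comp_apply, Prod.fst_swap, resolventKernel_swap]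
  have h3 := integrable_conj_mul_resolventKernel hlam hS
  have hae : differenceIntegrand lam φ =ᵐ[volume] fun z =>
      (6 * lam)⁻¹ * (‖φ z.1‖ ^ 2 * resolventKernel lam z +
        ‖φ z.2‖ ^ 2 * resolventKernel lam z -
        2 * ((starRingEnd ℂ) (φ z.1) * φ z.2 * ((resolventKernel lam z : ℝ) : ℂ)).re) := by
    filter_upwards [ae_quadD_pos] with z hz using differenceIntegrand_eq hlam φ hz
  have hD : Integrable (differenceIntegrand lam φ) :=
    (((h1.add h2).sub (h3.re.const_mul 2)).const_mul _).congr hae.symm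
  have e1 := integral_sq_norm_mul_resolventKernel hlam hS
  have e2 : ∫ z : E3 × E3, ‖φ z.2‖ ^ 2 * resolventKernel lam z =
      ∫ z : E3 × E3, ‖φ z.1‖ ^ 2 * resolventKernel lam z := by
    rw [Measure.volume_eq_prod, ← integral_prod_swap]
    simp only [Prod.snd_swap, resolventKernel_swap]
  set S := ∫ x : E3, singularIntegrand lam φ x with hS_def
  set D := ∫ z : E3 × E3, differenceIntegrand lam φ z with hD_def
  set R := ∫ z : E3 × E3, (starRingEnd ℂ) (φ z.1) * φ z.2 * ((resolventKernel lam z : ℝ) : ℂ)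
    with hR_def
  have e3 : R = (R.re : ℂ) :=
    (Complex.conj_eq_iff_re.1 (conj_integral_conj_mul_resolventKernel lam φ)).symm
  have e4 : D = (6 * lam)⁻¹ * (6 * √3 * π ^ 2 * S + 6 * √3 * π ^ 2 * S - 2 * R.re) := by
    have hre : ∫ z : E3 × E3, ((starRingEnd ℂ) (φ z.1) * φ z.2 *
        ((resolventKernel lam z : ℝ) : ℂ)).re = R.re := integral_re h3
    have hsub := integral_sub (h1.add h2) (h3.re.const_mul 2)
    rw [integral_add' h1 h2, e2, e1, integral_const_mul] at hsub
    rw [hD_def, integral_congr_ae hae, integral_const_mul, ← hre]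
    exact congrArg _ hsub
  have hSnn : 0 ≤ S := integral_nonneg (singularIntegrand_nonneg lam φ)
  have hDnn : 0 ≤ D := integral_nonneg (differenceIntegrand_nonneg lam φ)
  refine ⟨integrable_offIntegrand h hlam, hS, hD, ?_, ?_, by positivity⟩
  · have e5 := integral_conj_mul_resolventKernel h hlam
    have e6 := integral_offIntegrand lam φ
    have h3pos : (√3 : ℝ) ≠ 0 := by positivity
    -- The polarisation identity solved for the cross term.
    have e7 : R.re = 6 * √3 * π ^ 2 * S - 3 * lam * D := by
      rw [e4]
      field_simp
      ring
    -- The constant is (2π)³ / (24√3 π³) = 1/(3√3).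
    have e8 : phiOff lam φ = -(12 / (π : ℂ)) * ((((3 * √3)⁻¹ : ℝ) : ℂ) * R) := by
      rw [phiOff, e6, hR_def, e5, ← mul_assoc (((3 * √3)⁻¹ : ℝ) : ℂ), ← Complex.ofReal_mul]
      congr 3
      field_simp
      norm_num
    have e9 : -(12 / (π : ℂ)) = ((-(12 / π) : ℝ) : ℂ) := by push_cast; rfl
    rw [e8, e3, e7, e9, ← Complex.ofReal_mul, ← Complex.ofReal_mul, Complex.ofReal_inj]
    field_simp
    linear_combination -12 * lam * D * Real.sq_sqrt (show (0 : ℝ) ≤ 3 by norm_num)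
  · have := mul_nonneg Real.pi_pos.le hSnn
    nlinarith
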